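/- Let $M$ be a compact connected smooth Riemannian manifold (without boundary), let $H$ be a subgroup of its fundamental group $\pi_1(M)$, and let $p\colon\tilde M\to M$ be the connected covering corresponding to $H$ (that is, $p_*\pi_1(\tilde M)=H$ for suitable base points), equipped with the smooth structure and the Riemannian metric lifted from $M$. Let $A$ be any finite set of generators of $\pi_1(M)$, and let $\Gamma=\Gamma(\pi_1(M),H,A)$ be the Schreier graph: its vertices are the cosets $gH$, $g\in\pi_1(M)$, and for every $a\in A$ there is an oriented edge labelled $a$ from $gH$ to $agH$. For a point $y\in\tilde M$ let $\gamma_{\tilde M}(r)=\mathrm{Vol}(B_y(r))$ be the Riemannian volume of the ball of radius $r$ about $y$. For a vertex $v$ of $\Gamma$ let $\gamma_\Gamma(r)$ be the number of vertices of $\Gamma$ at combinatorial distance at most $\lfloor r\rfloor$ from $v$, where edges may be traversed in both directions. Then, for every choice of $y$ and $v$, the functions $\gamma_{\tilde M}$ and $\gamma_\Gamma$ are $\sim_1$-equivalent: there is a constant $C>0$ such that for all real $r\ge 1$ $$\gamma_{\tilde M}(r)\ \ge\ C\,\gamma_\Gamma(Cr)\qquad\text{and}\qquad \gamma_\Gamma(r)\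 \ge\ C\,\gamma_{\tilde M}(Cr).$$ -/

import Mathlib

open scoped Manifold ContDiff ENNReal Bundle

noncomputable section

namespace CoverGrowth

/-- The Gram matrix `g i j = ⟪∂ i, ∂ j⟫` of the Riemannian metric of a `d`-dimensional manifold in
the coordinates given by the preferred chart at `x`, as a function of the coordinate vector `u`. -/
def chartGram (d : ℕ) (M : Type*) [TopologicalSpace M]
    [ChartedSpace (EuclideanSpace ℝ (Fin d)) M]
    [Bundle.RiemannianBundle (fun y : M ↦ TangentSpace (𝓡 d) y)]
    (x : M) (u : EuclideanSpace ℝ (Fin d)) : Matrix (Fin d) (Fin d) ℝ :=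
  let φ := chartAt (EuclideanSpace ℝ (Fin d)) x
  let partialVec : Fin d → TangentSpace (𝓡 d) (φ.symm u) := fun i ↦
    mfderiv (𝓡 d) (𝓡 d) φ.symm u (EuclideanSpace.single i (1 : ℝ))
  Matrix.of fun i j ↦ inner ℝ (partialVec i) (partialVec j)

/-- The Riemannian volume on the domain of the preferred chart at `x`: the Borel measure
`B ↦ ∫ √(det g(u)) du`, the integral being over the coordinate vectors `u` of the points of `B`
that lie in the domain of the chart. -/
def chartVolume (d : ℕ) (M : Type*) [TopologicalSpace M]
    [ChartedSpace (EuclideanSpace ℝ (Fin d)) M]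
    [Bundle.RiemannianBundle (fun y : M ↦ TangentSpace (𝓡 d) y)]
    [MeasurableSpace M] (x : M) : MeasureTheory.Measure M :=
  let φ := chartAt (EuclideanSpace ℝ (Fin d)) x
  MeasureTheory.Measure.map φ.symm
    ((MeasureTheory.volume.restrict φ.target).withDensity
      fun u ↦ ENNReal.ofReal (Real.sqrt (chartGram d M x u).det))

/-- The Riemannian volume measure of a `d`-dimensional Riemannian manifold. By the change of
variables formula, the measures `chartVolume d M x` agree on overlaps of charts; their supremum, the
smallest measure that dominates all of them, is then (on a second countable manifold) the unique
Borel measure that restricts to `chartVolume d M x` on the domain of the chart at `x`, for all `x`. -/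
def riemannianVolume (d : ℕ) (M : Type*) [TopologicalSpace M]
    [ChartedSpace (EuclideanSpace ℝ (Fin d)) M]
    [Bundle.RiemannianBundle (fun y : M ↦ TangentSpace (𝓡 d) y)]
    [MeasurableSpace M] : MeasureTheory.Measure M :=
  ⨆ x : M, chartVolume d M x

/-- The growth function `r ↦ Vol (B_x(r))` of a Riemannian manifold. -/
def volumeGrowth (d : ℕ) {M : Type*} [EMetricSpace M]
    [ChartedSpace (EuclideanSpace ℝ (Fin d)) M]
    [Bundle.RiemannianBundle (fun y : M ↦ TangentSpace (𝓡 d) y)]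
    [MeasurableSpace M] (x : M) (r : ℝ) : ℝ≥0∞ :=
  riemannianVolume d M (Metric.eball x (ENNReal.ofReal r))

/-- The growth function of a graph (an oriented multigraph, given as a quiver): the number of
vertices at combinatorial distance at most `n` from `v`, where edges may be traversed in both
directions. -/
def graphGrowth {V : Type*} [Quiver V] (v : V) (n : ℕ) : ℝ≥0∞ :=
  ((Set.encard {w : V | ∃ p : Quiver.Path (Quiver.Symmetrify.of.obj v)
    (Quiver.Symmetrify.of.obj w), p.length ≤ n} : ℕ∞) : ℝ≥0∞)

/-- The Schreier graph of `(G, H, A)`: its vertices are the cosets `gH`, and for every `a ∈ A` it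
has an oriented edge labelled `a` from `gH` to `agH`. -/
abbrev Schreier {G : Type*} [Group G] (H : Subgroup G) (A : Set G) : Type _ :=
  Quiver.SchreierGraph (G ⧸ H) (Subtype.val : A → G)

/-- The growth function of the Schreier graph of `(G, H, A)` with base vertex `v`, its domain
extended to the reals by `γ(r) = γ([r])`. -/
def schreierGrowth {G : Type*} [Group G] (H : Subgroup G) (A : Set G) (v : G ⧸ H) (r : ℝ) :
    ℝ≥0∞ :=
  graphGrowth (Quiver.SchreierGraph.ofVertex v : Schreier H A) ⌊r⌋₊

/-- The equivalence `γ₁ ∼₁ γ₂` of growth functions. -/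
def SchwarzEquiv (γ₁ γ₂ : ℝ → ℝ≥0∞) : Prop :=
  ∃ C : ℝ, 0 < C ∧ ∀ r : ℝ, 1 ≤ r →
    ENNReal.ofReal C * γ₂ (C * r) ≤ γ₁ r ∧ ENNReal.ofReal C * γ₁ (C * r) ≤ γ₂ r

/-- `p : N → M` is a covering of smooth manifolds, and the Riemannian metric of `N` is the lift
(pull-back) of that of `M` under `p`. -/
structure IsRiemannianCovering (d : ℕ) {N M : Type*} [TopologicalSpace N] [TopologicalSpace M]
    [ChartedSpace (EuclideanSpace ℝ (Fin d)) N] [ChartedSpace (EuclideanSpace ℝ (Fin d)) M]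
    [Bundle.RiemannianBundle (fun y : N ↦ TangentSpace (𝓡 d) y)]
    [Bundle.RiemannianBundle (fun y : M ↦ TangentSpace (𝓡 d) y)] (p : N → M) : Prop where
  isCoveringMap : IsCoveringMap p
  isLocalDiffeomorph : IsLocalDiffeomorph (𝓡 d) (𝓡 d) ∞ p
  inner_mfderiv : ∀ (y : N) (v w : TangentSpace (𝓡 d) y),
    inner ℝ (mfderiv (𝓡 d) (𝓡 d) p y v) (mfderiv (𝓡 d) (𝓡 d) p y w) = inner ℝ v w

end CoverGrowth

end

/-! Monodromy identifies the fibre of `p` over `x₀` with the cosets of `H`, compatibly with the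
actions of the fundamental group (`exists_coset_fibre_bijective`), so the Schreier graph can be
drawn on the fibre. By compactness there is a scale δ such that two paths in a δ-ball of `M` with
the same ends are homotopic. Below this scale monodromy does not depend on the path, so `p` maps
δ-balls of `N` bijectively onto δ-balls of `M`, preserving volume; the volume of a small ball
depends only on its radius and the image of its centre (`riemannianVolume_eball`).

Lower bound: a generator moves all points of the fibre by a bounded distance, so the vertices within
distance n give fibre points in a metric ball of radius affine in n. Small balls about these points
are disjoint and have equal positive volume.

Upper bound: finitely many small balls cover `M`, and a path from each centre to `x₀` is fixed. The
lifts of these balls (`cell`) cover `N` and are labelled by vertices. The labels of nearby cells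
differ by one of finitely many group elements, one for each pair of centres, hence lie at bounded
graph distance. Cutting an almost shortest path into steps of length δ/3 shows that a metric ball
meets only cells with labels in a graph ball of comparable radius (`exists_reach_of_mem_cell`);
cells have bounded volume, and boundedly many share a label.

`schwarzEquiv_of_bounds` merges the constants of both bounds into one. -/

noncomputable section

namespace CoverGrowth

open Set Filter Topology Manifold MeasureTheory

/-! ### Distance as infimum of path lengths -/

section RiemannianDistance

variable {d : ℕ} {X : Type*} [EMetricSpace X] [ChartedSpace (EuclideanSpace ℝ (Fin d)) X]
  [Bundle.RiemannianBundle (fun y : X ↦ TangentSpace (𝓡 d) y)]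
  [IsRiemannianManifold (𝓡 d) X]

lemma edist_le_pathELength {γ : ℝ → X} {a b : ℝ} (hγ : ContMDiffOn 𝓘(ℝ, ℝ) (𝓡 d) 1 γ (Icc a b))
    (hab : a ≤ b) : edist (γ a) (γ b) ≤ pathELength (𝓡 d) γ a b := by
  rw [IsRiemannianManifold.out (I := 𝓡 d)]
  exact riemannianEDist_le_pathELength hγ rfl rfl hab

lemma exists_pathELength_lt {x y : X} {r : ℝ≥0∞} (h : edist x y < r) :
    ∃ γ : ℝ → X, γ 0 = x ∧ γ 1 = y ∧ ContMDiffOn 𝓘(ℝ, ℝ) (𝓡 d) 1 γ (Icc 0 1) ∧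
      pathELength (𝓡 d) γ 0 1 < r := by
  rw [IsRiemannianManifold.out (I := 𝓡 d)] at h
  exact exists_lt_of_riemannianEDist_lt h

variable (d) in
include d in
/-- Points at distance less than `r` are joined by a path that stays in the ball of radius `r`. -/
lemma exists_path_mem_eball {x y : X} {r : ℝ≥0∞} (h : edist x y < r) :
    ∃ γ : Path x y, ∀ t, γ t ∈ Metric.eball x r := by
  obtain ⟨γ, h0, h1, hγ, hlen⟩ := exists_pathELength_lt (d := d) h
  refine ⟨Path.ofLine hγ.continuousOn h0 h1, fun t ↦ ?_⟩
  have ht : Path.ofLine hγ.continuousOn h0 h1 t = γ t := rfl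
  rw [ht, Metric.mem_eball, edist_comm, ← h0]
  calc edist (γ 0) (γ t) ≤ pathELength (𝓡 d) γ 0 t :=
        edist_le_pathELength (hγ.mono (Icc_subset_Icc le_rfl t.2.2)) t.2.1
    _ ≤ pathELength (𝓡 d) γ 0 1 := pathELength_mono le_rfl t.2.2
    _ < r := hlen

variable (d) in
include d in
/-- A step of length at most `s` along an almost shortest path. -/
lemma exists_edist_le_of_lt {x y : X} {s r : ℝ≥0∞} (hs : s ≠ ⊤) (h : edist x y < s + r)
    (hr : 0 < r) : ∃ m, edist x m ≤ s ∧ edist m y < r := by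
  by_cases hxy : edist x y < s
  · exact ⟨y, hxy.le, by simpa using hr⟩
  obtain ⟨γ, h0, h1, hγ, hlen⟩ := exists_pathELength_lt (d := d) h
  have hc : ContinuousOn (fun t ↦ edist x (γ t)) (Icc 0 1) :=
    (continuous_const.edist continuous_id).comp_continuousOn hγ.continuousOn
  obtain ⟨t, ht, hts⟩ : s ∈ (fun t ↦ edist x (γ t)) '' Icc 0 1 := by
    apply intermediate_value_Icc zero_le_one hc
    simp only [h0, h1, edist_self, mem_Icc, zero_le, true_and]
    exact not_lt.1 hxy
  refine ⟨γ t, hts.le, ?_⟩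
  -- The point was chosen at distance exactly `s` from `x`, so reaching it uses up length at least
  -- `s` and less than `r` remains.
  have h2 : s ≤ pathELength (𝓡 d) γ 0 t := by
    have := edist_le_pathELength (hγ.mono (Icc_subset_Icc le_rfl ht.2)) ht.1
    rw [h0] at this
    exact hts.ge.trans this
  have h3 : edist (γ t) y ≤ pathELength (𝓡 d) γ t 1 := by
    have := edist_le_pathELength (hγ.mono (Icc_subset_Icc ht.1 le_rfl)) ht.2
    rwa [h1] at this
  have h4 : s + edist (γ t) y < s + r := by
    calc s + edist (γ t) y ≤ pathELength (𝓡 d) γ 0 t + pathELength (𝓡 d) γ t 1 := by gcongr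
      _ = pathELength (𝓡 d) γ 0 1 := pathELength_add ht.1 ht.2
      _ < s + r := hlen
  exact (ENNReal.add_lt_add_iff_left hs).1 h4

end RiemannianDistance

/-! ### Metric properties of a Riemannian covering -/

section Covering

variable {d : ℕ} {N M : Type*} [EMetricSpace N] [EMetricSpace M]
  [ChartedSpace (EuclideanSpace ℝ (Fin d)) N] [ChartedSpace (EuclideanSpace ℝ (Fin d)) M]
  [Bundle.RiemannianBundle (fun y : N ↦ TangentSpace (𝓡 d) y)]
  [Bundle.RiemannianBundle (fun y : M ↦ TangentSpace (𝓡 d) y)]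
  {p : N → M}

lemma IsRiemannianCovering.enorm_mfderiv (hp : IsRiemannianCovering d p) (y : N)
    (v : TangentSpace (𝓡 d) y) : ‖mfderiv (𝓡 d) (𝓡 d) p y v‖ₑ = ‖v‖ₑ := by
  have h : ‖mfderiv (𝓡 d) (𝓡 d) p y v‖ = ‖v‖ := by
    rw [@norm_eq_sqrt_real_inner, @norm_eq_sqrt_real_inner, hp.inner_mfderiv]
  rw [← ofReal_norm, ← ofReal_norm, h]

lemma IsRiemannianCovering.pathELength_comp (hp : IsRiemannianCovering d p) {γ : ℝ → N} {a b : ℝ}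
    (hγ : ContMDiffOn 𝓘(ℝ, ℝ) (𝓡 d) 1 γ (Icc a b)) :
    pathELength (𝓡 d) (p ∘ γ) a b = pathELength (𝓡 d) γ a b := by
  simp only [pathELength_eq_lintegral_mfderiv_Ioo]
  refine setLIntegral_congr_fun measurableSet_Ioo fun t ht ↦ ?_
  have h1 : MDifferentiableAt 𝓘(ℝ, ℝ) (𝓡 d) γ t :=
    ((hγ t (Ioo_subset_Icc_self ht)).contMDiffAt (Icc_mem_nhds ht.1 ht.2)).mdifferentiableAt
      one_ne_zero
  have h2 : MDifferentiableAt (𝓡 d) (𝓡 d) p (γ t) :=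
    (hp.isLocalDiffeomorph (γ t)).mdifferentiableAt (by simp)
  rw [mfderiv_comp t h2 h1]
  exact hp.enorm_mfderiv _ _

variable [IsRiemannianManifold (𝓡 d) N] [IsRiemannianManifold (𝓡 d) M]

/-- The image of a path has the same length. -/
lemma IsRiemannianCovering.edist_le (hp : IsRiemannianCovering d p) (y z : N) :
    edist (p y) (p z) ≤ edist y z := by
  refine le_of_forall_gt fun r hr ↦ ?_
  obtain ⟨γ, h0, h1, hγ, hlen⟩ := exists_pathELength_lt (d := d) hr
  have := edist_le_pathELength (d := d)
    (((hp.isLocalDiffeomorph.contMDiff.of_le (by simp)).comp_contMDiffOn hγ :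
      ContMDiffOn 𝓘(ℝ, ℝ) (𝓡 d) 1 (p ∘ γ) (Icc 0 1))) zero_le_one
  rw [hp.pathELength_comp hγ] at this
  simp only [Function.comp_apply, h0, h1] at this
  exact this.trans_lt hlen

/-- The lift of an almost shortest path has the same length, so its end point serves as `z`. -/
lemma IsRiemannianCovering.exists_edist_lt (hp : IsRiemannianCovering d p) {y : N} {x : M}
    {r : ℝ≥0∞} (h : edist (p y) x < r) : ∃ z, p z = x ∧ edist y z < r := by
  obtain ⟨γ, h0, h1, hγ, hlen⟩ := exists_pathELength_lt (d := d) h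
  let c := Path.ofLine hγ.continuousOn h0 h1
  let Γ := hp.isCoveringMap.liftPath c y c.source
  have hΓ : ∀ t, p (Γ t) = γ t := fun t ↦
    congr_fun (hp.isCoveringMap.liftPath_lifts c y c.source) t
  have hΓ0 : Γ 0 = y := hp.isCoveringMap.liftPath_zero c y c.source
  -- Path length is defined for functions on ℝ, so the lift is extended by constants outside the
  -- unit interval.
  let Γ' : ℝ → N := fun t ↦ Γ (projIcc 0 1 zero_le_one t)
  have hΓ' : Continuous Γ' := Γ.continuous.comp continuous_projIcc
  have hpΓ' : ∀ t ∈ Icc (0 : ℝ) 1, p (Γ' t) = γ t := fun t ht ↦ by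
    simp only [Γ', hΓ, projIcc_of_mem zero_le_one ht]
  have hsmooth : ContMDiffOn 𝓘(ℝ, ℝ) (𝓡 d) 1 Γ' (Icc 0 1) := by
    intro t ht
    -- By continuity the lift stays in the source of `Φ` near `t`, where it equals `Φ.symm ∘ γ`; it
    -- is therefore as smooth as `γ`.
    obtain ⟨Φ, hΦ, hpΦ⟩ := hp.isLocalDiffeomorph (Γ' t)
    have hsymm : ContMDiffAt (𝓡 d) (𝓡 d) 1 Φ.symm (γ t) := by
      refine ((Φ.symm.contMDiffOn _ ?_).contMDiffAt (Φ.open_target.mem_nhds ?_)).of_le (by simp)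
      all_goals
        rw [← hpΓ' t ht, hpΦ hΦ]
        exact Φ.map_source' hΦ
    refine (hsymm.comp_contMDiffWithinAt t (hγ t ht)).congr_of_eventuallyEq ?_ ?_
    · filter_upwards [mem_nhdsWithin_of_mem_nhds
        (hΓ'.continuousAt.preimage_mem_nhds (Φ.open_source.mem_nhds hΦ)),
        self_mem_nhdsWithin] with u hu hu'
      rw [Function.comp_apply, ← hpΓ' u hu', hpΦ hu]
      exact (Φ.left_inv' hu).symm
    · rw [Function.comp_apply, ← hpΓ' t ht, hpΦ hΦ]
      exact (Φ.left_inv' hΦ).symm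
  have hlen' : pathELength (𝓡 d) Γ' 0 1 = pathELength (𝓡 d) γ 0 1 := by
    rw [← hp.pathELength_comp hsmooth]
    exact pathELength_congr hpΓ'
  refine ⟨Γ' 1, (hpΓ' 1 (by simp)).trans h1, ?_⟩
  have := edist_le_pathELength hsmooth zero_le_one
  have h0' : Γ' 0 = y := by simp [Γ', hΓ0]
  rw [h0', hlen'] at this
  exact this.trans_lt hlen

end Covering

/-! ### A scale below which paths are determined up to homotopy -/

section SmallPaths

/-- Any two paths in `U` with the same end points are homotopic in the ambient space. -/
def PathsHomotopicIn {X : Type*} [TopologicalSpace X] (U : Set X) : Prop :=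
  ∀ ⦃a b : X⦄ (γ γ' : Path a b), (∀ t, γ t ∈ U) → (∀ t, γ' t ∈ U) → γ.Homotopic γ'

lemma PathsHomotopicIn.mono {X : Type*} [TopologicalSpace X] {U V : Set X}
    (h : PathsHomotopicIn V) (hUV : U ⊆ V) : PathsHomotopicIn U :=
  fun _ _ γ γ' hγ hγ' ↦ h γ γ' (fun t ↦ hUV (hγ t)) (fun t ↦ hUV (hγ' t))

/-- The preimage of a ball in a chart works: the ball is contractible, and a homotopy in it is
carried back by the inverse chart. -/
lemma exists_nhds_pathsHomotopicIn (d : ℕ) {X : Type*} [TopologicalSpace X]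
    [ChartedSpace (EuclideanSpace ℝ (Fin d)) X] (x : X) : ∃ U ∈ 𝓝 x, PathsHomotopicIn U := by
  let φ := chartAt (EuclideanSpace ℝ (Fin d)) x
  have hx : x ∈ φ.source := mem_chart_source _ x
  obtain ⟨r, hr, hball⟩ := Metric.mem_nhds_iff.1 (φ.open_target.mem_nhds (φ.map_source hx))
  refine ⟨φ.source ∩ φ ⁻¹' Metric.ball (φ x) r,
    inter_mem (φ.open_source.mem_nhds hx)
      ((φ.continuousAt hx).preimage_mem_nhds (Metric.ball_mem_nhds _ hr)), ?_⟩
  intro a b γ γ' hγ hγ'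
  have : ContractibleSpace (Metric.ball (φ x) r) := Metric.contractibleSpace_ball hr
  let s : C(Metric.ball (φ x) r, X) :=
    ⟨fun u ↦ φ.symm u, φ.continuousOn_symm.comp_continuous continuous_subtype_val
      fun u ↦ hball u.2⟩
  have key : ∀ (η : Path a b) (hη : ∀ t, η t ∈ φ.source ∩ φ ⁻¹' Metric.ball (φ x) r),
      ∃ η' : Path (⟨φ a, by simpa using (hη 0).2⟩ : Metric.ball (φ x) r)
        ⟨φ b, by simpa using (hη 1).2⟩, ∀ t, s (η' t) = η t := by
    intro η hη
    refine ⟨⟨⟨fun t ↦ ⟨φ (η t), (hη t).2⟩, ?_⟩, ?_, ?_⟩, fun t ↦ φ.left_inv (hη t).1⟩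
    · exact (φ.continuousOn.comp_continuous η.continuous fun t ↦ (hη t).1).subtype_mk _
    · simp
    · simp
  obtain ⟨η, hη⟩ := key γ hγ
  obtain ⟨η', hη'⟩ := key γ' hγ'
  have ha : a = s ⟨φ a, by simpa using (hγ 0).2⟩ := by simpa using (hη 0).symm
  have hb : b = s ⟨φ b, by simpa using (hγ 1).2⟩ := by simpa using (hη 1).symm
  have h := ((SimplyConnectedSpace.paths_homotopic η η').map s).pathCast ha hb
  convert h using 1
  · ext t; exact (hη t).symm
  · ext t; exact (hη' t).symm

/-- A uniform scale at which paths with the same end points are homotopic. -/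
lemma exists_pathsHomotopicIn_eball (d : ℕ) (X : Type*) [EMetricSpace X] [CompactSpace X]
    [ChartedSpace (EuclideanSpace ℝ (Fin d)) X] :
    ∃ δ : ℝ≥0∞, 0 < δ ∧ δ ≠ ⊤ ∧ ∀ x : X, PathsHomotopicIn (Metric.eball x δ) := by
  choose U hU hhU using exists_nhds_pathsHomotopicIn d (X := X)
  obtain ⟨δ, hδ, h⟩ := lebesgue_number_lemma_of_emetric_nhds (isCompact_univ (X := X))
    fun x _ ↦ hU x
  refine ⟨min δ 1, lt_min hδ one_pos, ne_top_of_le_ne_top ENNReal.one_ne_top (min_le_right _ _),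
    fun x ↦ ?_⟩
  obtain ⟨y, hy⟩ := h x (mem_univ x)
  exact (hhU y).mono ((Metric.eball_subset_eball (min_le_left _ _)).trans hy)

end SmallPaths

/-! ### Monodromy at small scale and along a fixed path -/

section Monodromy

variable {d : ℕ} {N M : Type*} [EMetricSpace N] [EMetricSpace M]
  [ChartedSpace (EuclideanSpace ℝ (Fin d)) N] [ChartedSpace (EuclideanSpace ℝ (Fin d)) M]
  [Bundle.RiemannianBundle (fun y : N ↦ TangentSpace (𝓡 d) y)]
  [Bundle.RiemannianBundle (fun y : M ↦ TangentSpace (𝓡 d) y)]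
  [IsRiemannianManifold (𝓡 d) N] [IsRiemannianManifold (𝓡 d) M]
  {p : N → M} {δ : ℝ≥0∞}

/-- A short path from `q` to `q'` projects into the δ-ball about `x`, hence to a path homotopic to
`σ`, and monodromy depends only on the homotopy class. -/
lemma IsRiemannianCovering.monodromy_eq_of_edist_lt (hp : IsRiemannianCovering d p)
    (hδ : ∀ x : M, PathsHomotopicIn (Metric.eball x δ)) {x x' : M} (σ : Path x x')
    (hσ : ∀ t, σ t ∈ Metric.eball x δ) {q : p ⁻¹' {x}} {q' : p ⁻¹' {x'}}
    (h : edist (q : N) q' < δ) : hp.isCoveringMap.monodromy (.mk σ) q = q' := by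
  obtain ⟨Γ, hΓ⟩ := exists_path_mem_eball d h
  have hq : p q = x := q.2
  have hq' : p q' = x' := q'.2
  have key : (Γ.map hp.isCoveringMap.continuous).Homotopic (σ.cast hq hq') := by
    refine hδ x _ _ (fun t ↦ ?_) hσ
    have h1 := (hp.edist_le (Γ t) q).trans_lt (hΓ t)
    rwa [hq] at h1
  exact hp.isCoveringMap.monodromy_eq_of_map_eq (.mk Γ) (Path.Homotopic.Quotient.eq.2 key)

/-- Both points are the monodromy image of `q` along one short path in `M`. -/
lemma IsRiemannianCovering.eq_of_edist_lt (hp : IsRiemannianCovering d p)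
    (hδ : ∀ x : M, PathsHomotopicIn (Metric.eball x δ)) {q z z' : N} (h : edist q z < δ)
    (h' : edist q z' < δ) (hzz' : p z = p z') : z = z' := by
  obtain ⟨σ, hσ⟩ := exists_path_mem_eball d ((hp.edist_le q z).trans_lt h)
  have h1 := hp.monodromy_eq_of_edist_lt hδ σ hσ (q := ⟨q, rfl⟩) (q' := ⟨z, rfl⟩) h
  have h2 := hp.monodromy_eq_of_edist_lt hδ σ hσ (q := ⟨q, rfl⟩) (q' := ⟨z', hzz'.symm⟩) h'
  exact congrArg Subtype.val (h1.symm.trans h2)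

lemma IsRiemannianCovering.injOn_eball (hp : IsRiemannianCovering d p)
    (hδ : ∀ x : M, PathsHomotopicIn (Metric.eball x δ)) (q : N) : InjOn p (Metric.eball q δ) :=
  fun _ hz _ hz' h ↦ hp.eq_of_edist_lt hδ (Metric.mem_eball'.1 hz) (Metric.mem_eball'.1 hz') h

lemma IsRiemannianCovering.image_eball (hp : IsRiemannianCovering d p) (q : N) (r : ℝ≥0∞) :
    p '' Metric.eball q r = Metric.eball (p q) r := by
  refine subset_antisymm ?_ fun x hx ↦ ?_
  · rintro _ ⟨z, hz, rfl⟩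
    exact (hp.edist_le z q).trans_lt hz
  · obtain ⟨z, hz, hqz⟩ := hp.exists_edist_lt (Metric.mem_eball'.1 hx)
    exact ⟨z, Metric.mem_eball'.2 hqz, hz⟩

/-- The end points of the lift of a short path are close. -/
lemma IsRiemannianCovering.edist_lt_of_lift (hp : IsRiemannianCovering d p)
    (hδ : ∀ x : M, PathsHomotopicIn (Metric.eball x δ)) {q q' : N} (Γ : Path q q')
    (hΓ : ∀ t, p (Γ t) ∈ Metric.eball (p q) δ) : edist q q' < δ := by
  have h1 : edist (p q) (p q') < δ := by
    rw [edist_comm]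
    simpa using hΓ 1
  -- The point `m` over `p q'` is near `q` by construction; monodromy along the projection of `Γ`
  -- sends `q` both to `m` and to `q'`.
  obtain ⟨m, hm, hqm⟩ := hp.exists_edist_lt h1
  have h2 := hp.monodromy_eq_of_edist_lt hδ (Γ.map hp.isCoveringMap.continuous) hΓ
    (q := ⟨q, rfl⟩) (q' := ⟨m, hm⟩) hqm
  have h3 := hp.isCoveringMap.monodromy_map (.mk Γ)
  rw [← Path.Homotopic.Quotient.mk_map] at h3
  have h4 := congrArg Subtype.val (h3.symm.trans h2)
  change q' = m at h4
  rwa [h4]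

/-- Monodromy along a given path moves the points of the fibre a bounded distance. -/
lemma IsRiemannianCovering.exists_edist_monodromy_le (hp : IsRiemannianCovering d p)
    (hδ0 : 0 < δ) (hδt : δ ≠ ⊤) (hδ : ∀ x : M, PathsHomotopicIn (Metric.eball x δ)) {x x' : M}
    (c : Path.Homotopic.Quotient x x') :
    ∃ L : ℝ≥0∞, L ≠ ⊤ ∧
      ∀ q : p ⁻¹' {x}, edist (q : N) (hp.isCoveringMap.monodromy c q) ≤ L := by
  obtain ⟨γ, rfl⟩ := Path.Homotopic.Quotient.mk_surjective c
  -- The subdivision depends on `γ` alone, so the number `n` of pieces is the same for all `q`.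
  -- Radius δ/2 keeps each piece within δ of its starting point.
  obtain ⟨t, ht0, htm, ⟨n, hn⟩, hcov⟩ := exists_monotone_Icc_subset_open_cover_unitInterval
    (c := fun z : M ↦ γ ⁻¹' Metric.eball z (δ / 2))
    (fun z ↦ Metric.isOpen_eball.preimage γ.continuous)
    (fun s _ ↦ mem_iUnion.2 ⟨γ s, Metric.mem_eball_self (ENNReal.half_pos hδ0.ne')⟩)
  refine ⟨n * δ, ENNReal.mul_ne_top (ENNReal.natCast_ne_top n) hδt, fun q ↦ ?_⟩
  have hq : γ 0 = p q := γ.source.trans q.2.symm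
  let Γ := hp.isCoveringMap.liftPath γ q hq
  have hΓ : ∀ s, p (Γ s) = γ s := fun s ↦
    congr_fun (hp.isCoveringMap.liftPath_lifts γ q hq) s
  have hΓ0 : Γ 0 = q := hp.isCoveringMap.liftPath_zero γ q hq
  have hΓ1 : (hp.isCoveringMap.monodromy (.mk γ) q : N) = Γ 1 := rfl
  let P : Path (Γ 0) (Γ 1) := ⟨Γ, rfl, rfl⟩
  have hstep : ∀ i, edist (Γ (t i)) (Γ (t (i + 1))) ≤ δ := by
    intro i
    obtain ⟨z, hz⟩ := hcov i
    refine (hp.edist_lt_of_lift hδ (P.subpath (t i) (t (i + 1))) fun s ↦ ?_).le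
    have hs : Icc.convexComb (t i) (t (i + 1)) s ∈ Icc (t i) (t (i + 1)) := by
      rw [← uIcc_of_le (htm i.le_succ), ← Path.range_subpathAux]
      exact mem_range_self s
    change p (Γ (Icc.convexComb (t i) (t (i + 1)) s)) ∈ Metric.eball (p (Γ (t i))) δ
    rw [hΓ, hΓ]
    calc edist (γ (Icc.convexComb (t i) (t (i + 1)) s)) (γ (t i))
        ≤ edist (γ (Icc.convexComb (t i) (t (i + 1)) s)) z + edist (γ (t i)) z :=
          edist_triangle_right _ _ _
      _ < δ / 2 + δ / 2 := ENNReal.add_lt_add (hz hs) (hz ⟨le_rfl, htm i.le_succ⟩)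
      _ = δ := ENNReal.add_halves δ
  calc edist (q : N) (hp.isCoveringMap.monodromy (.mk γ) q)
      = edist (Γ (t 0)) (Γ (t n)) := by rw [hΓ1, ht0, hn n le_rfl, hΓ0]
    _ ≤ ∑ i ∈ Finset.range n, edist (Γ (t i)) (Γ (t (i + 1))) :=
        edist_le_range_sum_edist (fun i ↦ Γ (t i)) n
    _ ≤ ∑ _i ∈ Finset.range n, δ := Finset.sum_le_sum fun i _ ↦ hstep i
    _ = n * δ := by simp

end Monodromy

/-! ### Distance in the Schreier graph -/

section Graph

variable {G : Type*} [Group G] {H : Subgroup G} {A : Set G}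

variable (H A) in
/-- The combinatorial distance of the vertices `v` and `w` of the Schreier graph is at most `n`. -/
def Reach (n : ℕ) (v w : G ⧸ H) : Prop :=
  ∃ P : Quiver.Path (Quiver.Symmetrify.of.obj (Quiver.SchreierGraph.ofVertex v : Schreier H A))
    (Quiver.Symmetrify.of.obj (Quiver.SchreierGraph.ofVertex w : Schreier H A)), P.length ≤ n

lemma schreierGrowth_eq (v : G ⧸ H) (r : ℝ) :
    schreierGrowth H A v r = ((encard {w | Reach H A ⌊r⌋₊ v w} : ℕ∞) : ℝ≥0∞) := by
  have : {w : Schreier H A | ∃ P : Quiver.Path (Quiver.Symmetrify.of.obj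
      (Quiver.SchreierGraph.ofVertex v : Schreier H A)) (Quiver.Symmetrify.of.obj w),
        P.length ≤ ⌊r⌋₊} = Quiver.SchreierGraph.ofVertex '' {w | Reach H A ⌊r⌋₊ v w} := by
    ext ⟨w⟩
    simp only [mem_ofPred_eq, mem_image, Reach]
    exact ⟨fun h ↦ ⟨w, h, rfl⟩, by rintro ⟨w', h, h'⟩; cases h'; exact h⟩
  rw [schreierGrowth, graphGrowth, this, Function.Injective.encard_image]
  exact (Quiver.SchreierGraph.equiv (G ⧸ H) _).injective

lemma Reach.refl (v : G ⧸ H) (n : ℕ) : Reach H A n v v := ⟨.nil, Nat.zero_le _⟩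

lemma Reach.mono {n m : ℕ} {v w : G ⧸ H} (h : Reach H A n v w) (hnm : n ≤ m) :
    Reach H A m v w := h.imp fun _ hP ↦ hP.trans hnm

lemma Reach.trans {n m : ℕ} {u v w : G ⧸ H} (h : Reach H A n u v) (h' : Reach H A m v w) :
    Reach H A (n + m) u w := by
  obtain ⟨P, hP⟩ := h
  obtain ⟨Q, hQ⟩ := h'
  exact ⟨P.comp Q, by rw [Quiver.Path.length_comp]; exact add_le_add hP hQ⟩

lemma Reach.smul {a : G} (ha : a ∈ A) (v : G ⧸ H) : Reach H A 1 v (a • v) := by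
  refine ⟨Quiver.Hom.toPath (.inl ⟨⟨a, ha⟩, rfl⟩), ?_⟩
  exact le_rfl

lemma Reach.inv_smul {a : G} (ha : a ∈ A) (v : G ⧸ H) : Reach H A 1 v (a⁻¹ • v) := by
  refine ⟨Quiver.Hom.toPath (.inr ⟨⟨a, ha⟩, ?_⟩), ?_⟩
  · exact congrArg Quiver.SchreierGraph.ofVertex (smul_inv_smul a v)
  · exact le_rfl

/-- The length of a word for `g` in the generators and their inverses bounds the distance, uniformly
in `v`. -/
lemma exists_reach_smul (hgen : Subgroup.closure A = ⊤) (g : G) :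
    ∃ n, ∀ v : G ⧸ H, Reach H A n v (g • v) := by
  have hg : g ∈ Subgroup.closure A := hgen ▸ Subgroup.mem_top g
  induction hg using Subgroup.closure_induction'' with
  | one => exact ⟨0, fun v ↦ by rw [one_smul]; exact .refl v 0⟩
  | mem a ha => exact ⟨1, .smul ha⟩
  | inv_mem a ha => exact ⟨1, .inv_smul ha⟩
  | mul a b _ _ iha ihb =>
    obtain ⟨n, hn⟩ := iha
    obtain ⟨m, hm⟩ := ihb
    exact ⟨m + n, fun v ↦ by rw [mul_smul]; exact (hm v).trans (hn _)⟩

lemma exists_reach (hgen : Subgroup.closure A = ⊤) (v w : G ⧸ H) : ∃ n, Reach H A n v w := by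
  obtain ⟨g, rfl⟩ := MulAction.exists_smul_eq G v w
  obtain ⟨n, hn⟩ := exists_reach_smul (H := H) hgen g
  exact ⟨n, hn v⟩

/-- A map that moves adjacent vertices at most `L` apart is `L`-Lipschitz. -/
lemma Reach.edist_le {X : Type*} [PseudoEMetricSpace X] {f : G ⧸ H → X} {L : ℝ≥0∞}
    (hf : ∀ a ∈ A, ∀ v, edist (f v) (f (a • v)) ≤ L) {n : ℕ} {v w : G ⧸ H}
    (h : Reach H A n v w) : edist (f v) (f w) ≤ n * L := by
  have key : ∀ (w' : Quiver.Symmetrify (Schreier H A)) (P : Quiver.Path (Quiver.Symmetrify.of.obj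
      (Quiver.SchreierGraph.ofVertex v : Schreier H A)) w'),
      edist (f v) (f (Quiver.SchreierGraph.toVertex (V := G ⧸ H) w')) ≤ P.length * L := by
    intro w' P
    induction P with
    | nil => simp [Quiver.Symmetrify.of]
    | @cons b c P e ih =>
      refine (edist_triangle _ (f (Quiver.SchreierGraph.toVertex (V := G ⧸ H) b)) _).trans ?_
      rw [Quiver.Path.length_cons, Nat.cast_add, Nat.cast_one, add_mul, one_mul]
      refine add_le_add ih ?_
      rcases e with ⟨⟨a, ha⟩, h⟩ | ⟨⟨a, ha⟩, h⟩
      · rw [← h]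
        exact hf a ha _
      · rw [← h, edist_comm]
        exact hf a ha _
  obtain ⟨P, hP⟩ := h
  refine (key _ P).trans ?_
  gcongr

end Graph

/-! ### Cosets and the fibre -/

section Fibre

lemma _root_.IsCoveringMap.monodromy_symm_apply {E X : Type*} [TopologicalSpace E]
    [TopologicalSpace X] {p : E → X} (cov : IsCoveringMap p) {x y : X}
    (c : Path.Homotopic.Quotient x y) (q : p ⁻¹' {x}) :
    cov.monodromy c.symm (cov.monodromy c q) = q := by
  rw [← cov.monodromy_trans_apply, Path.Homotopic.Quotient.trans_symm, cov.monodromy_refl, id]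

/-- A loop comes from `N` exactly when its lift starting at `y₀` closes up. -/
lemma mem_range_mapOfEq_iff {N M : Type*} [TopologicalSpace N] [TopologicalSpace M] (p : C(N, M))
    (cov : IsCoveringMap p) {x₀ : M} {y₀ : N} (hy₀ : p y₀ = x₀) (g : FundamentalGroup M x₀) :
    g ∈ (FundamentalGroup.mapOfEq p hy₀).range ↔ cov.monodromy g ⟨y₀, hy₀⟩ = ⟨y₀, hy₀⟩ := by
  subst hy₀
  constructor
  · rintro ⟨γ, rfl⟩
    refine cov.monodromy_eq_of_map_eq (ex := ⟨y₀, rfl⟩) (ey := ⟨y₀, rfl⟩) γ ?_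
    exact ((FundamentalGroup.mapOfEq_apply p rfl γ).trans (Path.Homotopic.Quotient.cast_rfl_rfl _)
      |>.symm).trans (Path.Homotopic.Quotient.cast_rfl_rfl _).symm
  · intro h
    -- The end of the lift is kept as a variable, so that its equality with `y₀` can be substituted.
    have key : ∀ (q : p ⁻¹' {p y₀}) (Γ : Path.Homotopic.Quotient y₀ q), q = ⟨y₀, rfl⟩ →
        Γ.map ⟨p, cov.continuous⟩ = Path.Homotopic.Quotient.cast g rfl q.2 →
          g ∈ (FundamentalGroup.mapOfEq p rfl).range := by
      rintro _ Γ rfl hΓ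
      exact ⟨Γ, (FundamentalGroup.mapOfEq_apply p rfl Γ).trans <|
        (Path.Homotopic.Quotient.cast_rfl_rfl _).trans <|
        hΓ.trans (Path.Homotopic.Quotient.cast_rfl_rfl _)⟩
    exact key _ _ h (cov.map_liftPathQuotient g ⟨y₀, rfl⟩)

/-- The cosets of the subgroup of a covering correspond to the points of a fibre. -/
lemma exists_coset_fibre_bijective {N M : Type*} [TopologicalSpace N] [TopologicalSpace M]
    [PathConnectedSpace N] (p : C(N, M)) (cov : IsCoveringMap p) {x₀ : M}
    {H : Subgroup (FundamentalGroup M x₀)} {y₀ : N} (hy₀ : p y₀ = x₀)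
    (hH : (FundamentalGroup.mapOfEq p hy₀).range = H) :
    ∃ f : FundamentalGroup M x₀ ⧸ H → p ⁻¹' {x₀}, Function.Bijective f ∧
      ∀ (g : FundamentalGroup M x₀) v, f (g • v) = cov.monodromy g (f v) := by
  let := cov.fundamentalGroupMulAction x₀
  let b : p ⁻¹' {x₀} := ⟨y₀, hy₀⟩
  -- Orbit–stabilizer: `H` is the stabilizer of `y₀`, and the action on the fibre is transitive
  -- because a path in `N` from `y₀` to `q` projects to a loop that moves `y₀` to `q`.
  obtain rfl : MulAction.stabilizer (FundamentalGroup M x₀) b = H := by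
    rw [← hH]
    ext g
    rw [mem_range_mapOfEq_iff p cov]
    rfl
  refine ⟨MulAction.ofQuotientStabilizer _ b,
    ⟨MulAction.injective_ofQuotientStabilizer _ b, fun q ↦ ?_⟩,
    fun g v ↦ MulAction.ofQuotientStabilizer_smul _ b g v⟩
  have hq : p q = x₀ := q.2
  let Γ : Path y₀ q := PathConnectedSpace.somePath y₀ q
  let g : FundamentalGroup M x₀ :=
    Path.Homotopic.Quotient.mk ((Γ.map p.continuous).cast hy₀.symm hq.symm)
  refine ⟨QuotientGroup.mk g, ?_⟩
  rw [MulAction.ofQuotientStabilizer_mk]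
  exact cov.monodromy_eq_of_map_eq (ex := b) (ey := q) (.mk Γ) rfl

end Fibre

/-! ### Cells of the covering space and their labels -/

section Coarse

variable {d : ℕ} {N M : Type*} [EMetricSpace N] [EMetricSpace M]
  [ChartedSpace (EuclideanSpace ℝ (Fin d)) N] [ChartedSpace (EuclideanSpace ℝ (Fin d)) M]
  [Bundle.RiemannianBundle (fun y : N ↦ TangentSpace (𝓡 d) y)]
  [Bundle.RiemannianBundle (fun y : M ↦ TangentSpace (𝓡 d) y)]
  [IsRiemannianManifold (𝓡 d) N] [IsRiemannianManifold (𝓡 d) M]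
  {p : N → M} {δ : ℝ≥0∞} {x₀ : M} {H : Subgroup (FundamentalGroup M x₀)}
  {A : Set (FundamentalGroup M x₀)} {f : FundamentalGroup M x₀ ⧸ H → p ⁻¹' {x₀}}
  {c : ∀ z, Path.Homotopic.Quotient z x₀}

/-- If nearby points over a finite set are moved to a fibre along fixed paths, then the resulting
vertices of the Schreier graph are at a bounded distance. -/
lemma IsRiemannianCovering.exists_reach_of_edist_lt (hp : IsRiemannianCovering d p)
    (hδ : ∀ x : M, PathsHomotopicIn (Metric.eball x δ)) (hgen : Subgroup.closure A = ⊤)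
    (hf : Function.Injective f)
    (hfs : ∀ (g : FundamentalGroup M x₀) v, f (g • v) = hp.isCoveringMap.monodromy g (f v))
    (c : ∀ z, Path.Homotopic.Quotient z x₀) (t : Finset M) :
    ∃ K, ∀ z ∈ t, ∀ z' ∈ t, ∀ (q : p ⁻¹' {z}) (q' : p ⁻¹' {z'}), edist (q : N) q' < δ →
      ∀ w w', f w = hp.isCoveringMap.monodromy (c z) q →
        f w' = hp.isCoveringMap.monodromy (c z') q' → Reach H A K w w' := by
  have key : ∀ z z', ∃ K, ∀ (q : p ⁻¹' {z}) (q' : p ⁻¹' {z'}), edist (q : N) q' < δ →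
      ∀ w w', f w = hp.isCoveringMap.monodromy (c z) q →
        f w' = hp.isCoveringMap.monodromy (c z') q' → Reach H A K w w' := by
    intro z z'
    by_cases hz : edist z z' < δ
    · obtain ⟨σ, hσ⟩ := exists_path_mem_eball d hz
      -- Back along `c z`, across by `σ`, forward along `c z'`: this loop depends only on `z` and
      -- `z'`.
      let g : FundamentalGroup M x₀ := (c z).symm.trans (.trans (.mk σ) (c z'))
      obtain ⟨K, hK⟩ := exists_reach_smul (H := H) hgen g
      refine ⟨K, fun q q' hqq' w w' hw hw' ↦ ?_⟩
      have : w' = g • w := by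
        apply hf
        rw [hfs, hw, hw', hp.isCoveringMap.monodromy_trans_apply,
          hp.isCoveringMap.monodromy_symm_apply, hp.isCoveringMap.monodromy_trans_apply,
          hp.monodromy_eq_of_edist_lt hδ σ hσ hqq']
      rw [this]
      exact hK w
    · refine ⟨0, fun q q' hqq' ↦ (hz ?_).elim⟩
      have h1 : p q = z := q.2
      have h2 : p q' = z' := q'.2
      rw [← h1, ← h2]
      exact (hp.edist_le _ _).trans_lt hqq'
  choose K hK using key
  refine ⟨(t ×ˢ t).sup fun a ↦ K a.1 a.2, fun z hz z' hz' q q' hqq' w w' hw hw' ↦ ?_⟩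
  exact (hK z z' q q' hqq' w w' hw hw').mono
    (Finset.le_sup (f := fun a : M × M ↦ K a.1 a.2) (Finset.mk_mem_product hz hz'))

/-- The set of points near the point of the fibre over `z` that monodromy along `c z` moves to the
point `f w`. -/
def cell (cov : IsCoveringMap p) (f : FundamentalGroup M x₀ ⧸ H → p ⁻¹' {x₀})
    (c : ∀ z, Path.Homotopic.Quotient z x₀) (ρ : M → ℝ≥0∞) (z : M)
    (w : FundamentalGroup M x₀ ⧸ H) : Set N :=
  {q | ∃ q' : p ⁻¹' {z}, edist q q' < ρ z ∧ f w = cov.monodromy (c z) q'}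

/-- Monodromy along `c z` is bijective, so a single point over `z` carries the label `w`. -/
lemma exists_cell_subset_eball (cov : IsCoveringMap p) (ρ : M → ℝ≥0∞) (z : M)
    (w : FundamentalGroup M x₀ ⧸ H) :
    ∃ q, p q = z ∧ cell cov f c ρ z w ⊆ Metric.eball q (ρ z) := by
  obtain ⟨q, hq⟩ := (cov.monodromy_bijective (c z)).surjective (f w)
  refine ⟨q, q.2, ?_⟩
  rintro y ⟨q', hyq', hq'⟩
  rwa [(cov.monodromy_bijective (c z)).injective (hq.trans hq')]

lemma IsRiemannianCovering.exists_mem_cell (hp : IsRiemannianCovering d p)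
    (hf : Function.Surjective f) {ρ : M → ℝ≥0∞} {t : Finset M}
    (ht : ∀ x, ∃ z ∈ t, x ∈ Metric.eball z (ρ z)) (q : N) :
    ∃ z ∈ t, ∃ w, q ∈ cell hp.isCoveringMap f c ρ z w := by
  obtain ⟨z, hz, hqz⟩ := ht (p q)
  obtain ⟨q', rfl, hqq'⟩ := hp.exists_edist_lt hqz
  obtain ⟨w, hw⟩ := hf (hp.isCoveringMap.monodromy (c (p q')) ⟨q', rfl⟩)
  exact ⟨p q', hz, w, ⟨q', rfl⟩, hqq', hw⟩

/-- The labelling is coarsely Lipschitz. A step of length at most `s` changes the label by at most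
`K`: the cell centres are then less than `s + s + s ≤ δ` apart. Longer distances are covered step by
step, each intermediate point lying in some cell. -/
lemma IsRiemannianCovering.exists_reach_of_mem_cell (hp : IsRiemannianCovering d p)
    (hδ : ∀ x : M, PathsHomotopicIn (Metric.eball x δ)) (hgen : Subgroup.closure A = ⊤)
    (hf : Function.Bijective f)
    (hfs : ∀ (g : FundamentalGroup M x₀) v, f (g • v) = hp.isCoveringMap.monodromy g (f v))
    {ρ : M → ℝ≥0∞} {t : Finset M} (ht : ∀ x, ∃ z ∈ t, x ∈ Metric.eball z (ρ z))
    {s : ℝ≥0∞} (hs0 : 0 < s) (hst : s ≠ ⊤) (hsδ : s + s + s ≤ δ) (hρ : ∀ z, ρ z ≤ s) :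
    ∃ K, ∀ n : ℕ, ∀ q q' : N, edist q q' < n * s → ∀ z ∈ t, ∀ z' ∈ t, ∀ w w',
      q ∈ cell hp.isCoveringMap f c ρ z w → q' ∈ cell hp.isCoveringMap f c ρ z' w' →
      Reach H A (n * K) w w' := by
  obtain ⟨K, hK⟩ := hp.exists_reach_of_edist_lt hδ hgen hf.injective hfs c t
  have step : ∀ q q' : N, edist q q' ≤ s → ∀ z ∈ t, ∀ z' ∈ t, ∀ w w',
      q ∈ cell hp.isCoveringMap f c ρ z w → q' ∈ cell hp.isCoveringMap f c ρ z' w' →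
      Reach H A K w w' := by
    rintro q q' hqq' z hz z' hz' w w' ⟨a, ha, hw⟩ ⟨a', ha', hw'⟩
    refine hK z hz z' hz' a a' (lt_of_lt_of_le ?_ hsδ) w w' hw hw'
    calc edist (a : N) a' ≤ edist (a : N) q + edist q q' + edist q' a' := edist_triangle4 _ _ _ _
      _ < s + s + s := by
        refine ENNReal.add_lt_add (ENNReal.add_lt_add_of_lt_of_le
          (ne_top_of_le_ne_top hst hqq') ?_ hqq') (ha'.trans_le (hρ z'))
        rw [edist_comm]
        exact ha.trans_le (hρ z)
  refine ⟨K, fun n ↦ ?_⟩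
  induction n with
  | zero => intro q q' h; simp at h
  | succ n ih =>
    intro q q' h z hz z' hz' w w' hw hw'
    -- Splitting off a step requires a positive remaining bound `n * s`, so a single step is treated
    -- separately.
    rcases Nat.eq_zero_or_pos n with rfl | hn
    · rw [Nat.zero_add, Nat.cast_one, one_mul] at h
      rw [Nat.zero_add, one_mul]
      exact step q q' h.le z hz z' hz' w w' hw hw'
    · rw [Nat.cast_add, Nat.cast_one, add_mul, one_mul, add_comm] at h
      obtain ⟨m, hqm, hmq'⟩ := exists_edist_le_of_lt d hst h
        (ENNReal.mul_pos (by exact_mod_cast hn.ne') hs0.ne')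
      obtain ⟨z₁, hz₁, w₁, hw₁⟩ := hp.exists_mem_cell (c := c) hf.surjective ht m
      rw [add_mul, one_mul, add_comm]
      exact (step q m hqm z hz z₁ hz₁ w w₁ hw hw₁).trans
        (ih m q' hmq' z₁ hz₁ z' hz' w₁ w' hw₁ hw')

end Coarse

/-! ### Volume densities in charts -/

section ModelDeriv

variable {d : ℕ} {X Y Z : Type*} [TopologicalSpace X] [TopologicalSpace Y] [TopologicalSpace Z]
  [ChartedSpace (EuclideanSpace ℝ (Fin d)) X] [ChartedSpace (EuclideanSpace ℝ (Fin d)) Y]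
  [ChartedSpace (EuclideanSpace ℝ (Fin d)) Z]

variable (d) in
/-- The derivative of a map of manifolds, as an endomorphism of the model space. -/
def modelDeriv (f : X → Y) (x : X) : Module.End ℝ (EuclideanSpace ℝ (Fin d)) :=
  ContinuousLinearMap.toLinearMap (M := EuclideanSpace ℝ (Fin d))
    (M₂ := EuclideanSpace ℝ (Fin d)) (mfderiv (𝓡 d) (𝓡 d) f x)

lemma modelDeriv_comp {g : Y → Z} {f : X → Y} {x : X}
    (hg : MDifferentiableAt (𝓡 d) (𝓡 d) g (f x)) (hf : MDifferentiableAt (𝓡 d) (𝓡 d) f x) :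
    modelDeriv d (g ∘ f) x = modelDeriv d g (f x) ∘ₗ modelDeriv d f x := by
  rw [modelDeriv, mfderiv_comp x hg hf]
  rfl

lemma modelDeriv_congr {f g : X → Y} {x : X} (h : f =ᶠ[𝓝 x] g) :
    modelDeriv d f x = modelDeriv d g x := by
  rw [modelDeriv, modelDeriv, h.mfderiv_eq]

lemma modelDeriv_id (x : X) : modelDeriv d (id : X → X) x = LinearMap.id := by
  rw [modelDeriv, mfderiv_id]
  rfl

end ModelDeriv

section MetricForm

variable {d : ℕ} {M : Type*} [TopologicalSpace M] [ChartedSpace (EuclideanSpace ℝ (Fin d)) M]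
  [Bundle.RiemannianBundle (fun y : M ↦ TangentSpace (𝓡 d) y)]

variable (d) in
/-- The metric at `m`, as a bilinear form on the model space. -/
def metricForm (m : M) : LinearMap.BilinForm ℝ (EuclideanSpace ℝ (Fin d)) :=
  LinearMap.mk₂ ℝ (fun v w ↦ @inner ℝ (TangentSpace (𝓡 d) m) _ v w)
    (fun _ _ _ ↦ inner_add_left (E := TangentSpace (𝓡 d) m) _ _ _)
    (fun _ _ _ ↦ real_inner_smul_left (F := TangentSpace (𝓡 d) m) _ _ _)
    (fun _ _ _ ↦ inner_add_right (E := TangentSpace (𝓡 d) m) _ _ _)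
    (fun _ _ _ ↦ real_inner_smul_right (F := TangentSpace (𝓡 d) m) _ _ _)

/-- The determinant of the matrix of a bilinear form in the standard basis. -/
def formDet (B : LinearMap.BilinForm ℝ (EuclideanSpace ℝ (Fin d))) : ℝ :=
  (LinearMap.BilinForm.toMatrix (EuclideanSpace.basisFun (Fin d) ℝ).toBasis B).det

lemma formDet_comp (B : LinearMap.BilinForm ℝ (EuclideanSpace ℝ (Fin d)))
    (l : Module.End ℝ (EuclideanSpace ℝ (Fin d))) :
    formDet (B.comp l l) = LinearMap.det l ^ 2 * formDet B := by
  set b := (EuclideanSpace.basisFun (Fin d) ℝ).toBasis with hb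
  have h : LinearMap.BilinForm.toMatrix b (B.comp l l) = (LinearMap.toMatrix b b l).transpose *
      LinearMap.BilinForm.toMatrix b B * LinearMap.toMatrix b b l :=
    LinearMap.BilinForm.toMatrix_comp b b B l l
  rw [formDet, h, Matrix.det_mul, Matrix.det_mul, Matrix.det_transpose, LinearMap.det_toMatrix,
    formDet]
  ring

lemma formDet_metricForm_pos (m : M) : 0 < formDet (metricForm d m) := by
  let e : Fin d → TangentSpace (𝓡 d) m := fun i ↦ (EuclideanSpace.basisFun (Fin d) ℝ).toBasis i
  have h : LinearIndependent ℝ e := (EuclideanSpace.basisFun (Fin d) ℝ).toBasis.linearIndependent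
  have h' : LinearMap.BilinForm.toMatrix (EuclideanSpace.basisFun (Fin d) ℝ).toBasis
      (metricForm d m) = Matrix.gram ℝ e := by
    ext i j
    rw [LinearMap.BilinForm.toMatrix_apply]
    rfl
  rw [formDet, h']
  exact (Matrix.posDef_gram_of_linearIndependent h).det_pos

/-- The Gram matrix represents the metric pulled back by the inverse chart, so `formDet_comp` splits
off the squared Jacobian. -/
lemma det_chartGram (x : M) (u : EuclideanSpace ℝ (Fin d)) :
    (chartGram d M x u).det =
      LinearMap.det (modelDeriv d (chartAt (EuclideanSpace ℝ (Fin d)) x).symm u) ^ 2 *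
      formDet (metricForm d ((chartAt (EuclideanSpace ℝ (Fin d)) x).symm u)) := by
  rw [← formDet_comp, formDet]
  congr 1

end MetricForm

section Chart

variable {d : ℕ} {M : Type*} [TopologicalSpace M] [ChartedSpace (EuclideanSpace ℝ (Fin d)) M]
  [IsManifold (𝓡 d) ∞ M]

lemma mdifferentiableAt_chartAt_symm (x : M) {u : EuclideanSpace ℝ (Fin d)}
    (hu : u ∈ (chartAt (EuclideanSpace ℝ (Fin d)) x).target) :
    MDifferentiableAt (𝓡 d) (𝓡 d) (chartAt (EuclideanSpace ℝ (Fin d)) x).symm u :=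
  ((contMDiffOn_chart_symm (n := ∞) u hu).contMDiffAt
    ((chartAt (EuclideanSpace ℝ (Fin d)) x).open_target.mem_nhds hu)).mdifferentiableAt (by simp)

lemma mdifferentiableAt_chartAt (x : M) {y : M}
    (hy : y ∈ (chartAt (EuclideanSpace ℝ (Fin d)) x).source) :
    MDifferentiableAt (𝓡 d) (𝓡 d) (chartAt (EuclideanSpace ℝ (Fin d)) x) y :=
  ((contMDiffOn_chart (n := ∞) y hy).contMDiffAt
    ((chartAt (EuclideanSpace ℝ (Fin d)) x).open_source.mem_nhds hy)).mdifferentiableAt (by simp)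

lemma det_modelDeriv_chartAt_symm_ne_zero (x : M) {u : EuclideanSpace ℝ (Fin d)}
    (hu : u ∈ (chartAt (EuclideanSpace ℝ (Fin d)) x).target) :
    LinearMap.det (modelDeriv d (chartAt (EuclideanSpace ℝ (Fin d)) x).symm u) ≠ 0 := by
  set φ := chartAt (EuclideanSpace ℝ (Fin d)) x with hφ
  have h3 : modelDeriv d (φ ∘ φ.symm) u = LinearMap.id := by
    rw [← modelDeriv_id u]
    apply modelDeriv_congr
    filter_upwards [φ.open_target.mem_nhds hu] with v hv using φ.right_inv hv
  rw [modelDeriv_comp (mdifferentiableAt_chartAt x (φ.map_target hu))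
    (mdifferentiableAt_chartAt_symm x hu)] at h3
  intro h0
  have h4 := congrArg LinearMap.det h3
  rw [LinearMap.det_comp, h0, mul_zero, LinearMap.det_id] at h4
  exact zero_ne_one h4

variable [Bundle.RiemannianBundle (fun y : M ↦ TangentSpace (𝓡 d) y)]

lemma det_chartGram_pos (x : M) {u : EuclideanSpace ℝ (Fin d)}
    (hu : u ∈ (chartAt (EuclideanSpace ℝ (Fin d)) x).target) : 0 < (chartGram d M x u).det := by
  rw [det_chartGram]
  exact mul_pos (by positivity [det_modelDeriv_chartAt_symm_ne_zero x hu])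
    (formDet_metricForm_pos _)

/-- The coordinate fields are images of constant fields under the tangent map of the inverse chart,
hence continuous, and so are their inner products. -/
lemma continuousOn_chartGram
    [IsContMDiffRiemannianBundle (𝓡 d) ∞ (EuclideanSpace ℝ (Fin d))
      (fun y : M ↦ TangentSpace (𝓡 d) y)] (x : M) :
    ContinuousOn (chartGram d M x) (chartAt (EuclideanSpace ℝ (Fin d)) x).target := by
  set φ := chartAt (EuclideanSpace ℝ (Fin d)) x with hφ
  have hsec : ∀ i : Fin d, ContMDiffOn (𝓡 d) (𝓡 d).tangent 0
      (fun u ↦ (⟨φ.symm u, mfderiv (𝓡 d) (𝓡 d) φ.symm u (EuclideanSpace.single i (1 : ℝ))⟩ :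
        TangentBundle (𝓡 d) M)) φ.target := by
    intro i
    have h1 : ContinuousOn (tangentMapWithin (𝓡 d) (𝓡 d) φ.symm φ.target)
        (Bundle.TotalSpace.proj ⁻¹' φ.target) :=
      (contMDiffOn_chart_symm (n := ∞)).continuousOn_tangentMapWithin (by simp)
        φ.open_target.uniqueMDiffOn
    have h2 : Continuous fun u : EuclideanSpace ℝ (Fin d) ↦
        (⟨u, EuclideanSpace.single i (1 : ℝ)⟩ : TangentBundle (𝓡 d) (EuclideanSpace ℝ (Fin d))) :=
      (tangentBundleModelSpaceHomeomorph (𝓡 d)).symm.continuous.comp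
        (continuous_id.prodMk continuous_const)
    rw [contMDiffOn_zero_iff]
    refine (h1.comp h2.continuousOn fun u hu ↦ hu).congr fun u hu ↦ ?_
    simp only [Function.comp_apply, tangentMapWithin]
    rw [mfderivWithin_of_mem_nhds (φ.open_target.mem_nhds hu)]
  have : IsContMDiffRiemannianBundle (𝓡 d) 0 (EuclideanSpace ℝ (Fin d))
      (fun y : M ↦ TangentSpace (𝓡 d) y) := IsContMDiffRiemannianBundle.of_le (n := ∞) (by simp)
  refine continuousOn_pi.2 fun i ↦ continuousOn_pi.2 fun j ↦ ?_
  exact (ContMDiffOn.inner_bundle (n := 0) (IB := 𝓡 d) (F := EuclideanSpace ℝ (Fin d))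
    (E := fun y : M ↦ TangentSpace (𝓡 d) y) (hsec i) (hsec j)).continuousOn

end Chart

section ChangeOfVariables

variable {d : ℕ} {N M : Type*} [TopologicalSpace N] [TopologicalSpace M]
  [ChartedSpace (EuclideanSpace ℝ (Fin d)) N] [ChartedSpace (EuclideanSpace ℝ (Fin d)) M]
  [Bundle.RiemannianBundle (fun y : N ↦ TangentSpace (𝓡 d) y)]
  [Bundle.RiemannianBundle (fun y : M ↦ TangentSpace (𝓡 d) y)]
  {p : N → M}

lemma IsRiemannianCovering.metricForm_eq (hp : IsRiemannianCovering d p) (y : N) :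
    metricForm d y = (metricForm d (p y)).comp (modelDeriv d p y) (modelDeriv d p y) :=
  LinearMap.ext fun v ↦ LinearMap.ext fun w ↦ (hp.inner_mfderiv y v w).symm

variable [IsManifold (𝓡 d) ∞ N] [IsManifold (𝓡 d) ∞ M]

/-- The volume densities in a chart of the covering and in a chart of the base are related by the
Jacobian determinant of the covering map in these charts. -/
lemma IsRiemannianCovering.sqrt_det_chartGram (hp : IsRiemannianCovering d p) (x : N) (x' : M)
    {u : EuclideanSpace ℝ (Fin d)} (hu : u ∈ (chartAt (EuclideanSpace ℝ (Fin d)) x).target)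
    (hpu : p ((chartAt (EuclideanSpace ℝ (Fin d)) x).symm u) ∈
      (chartAt (EuclideanSpace ℝ (Fin d)) x').source) :
    DifferentiableAt ℝ (chartAt (EuclideanSpace ℝ (Fin d)) x' ∘ p ∘
      (chartAt (EuclideanSpace ℝ (Fin d)) x).symm) u ∧
    Real.sqrt (chartGram d N x u).det =
      |(fderiv ℝ (chartAt (EuclideanSpace ℝ (Fin d)) x' ∘ p ∘
        (chartAt (EuclideanSpace ℝ (Fin d)) x).symm) u).det| *
      Real.sqrt (chartGram d M x' (chartAt (EuclideanSpace ℝ (Fin d)) x'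
        (p ((chartAt (EuclideanSpace ℝ (Fin d)) x).symm u)))).det := by
  set φ := chartAt (EuclideanSpace ℝ (Fin d)) x with hφ
  set ψ := chartAt (EuclideanSpace ℝ (Fin d)) x' with hψ
  have h1 : MDifferentiableAt (𝓡 d) (𝓡 d) φ.symm u := mdifferentiableAt_chartAt_symm x hu
  have h2 : MDifferentiableAt (𝓡 d) (𝓡 d) p (φ.symm u) :=
    (hp.isLocalDiffeomorph _).mdifferentiableAt (by simp)
  have h3 : MDifferentiableAt (𝓡 d) (𝓡 d) ψ (p (φ.symm u)) := mdifferentiableAt_chartAt x' hpu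
  have h4 : MDifferentiableAt (𝓡 d) (𝓡 d) ψ.symm (ψ (p (φ.symm u))) :=
    mdifferentiableAt_chartAt_symm x' (ψ.map_source hpu)
  have h5 : MDifferentiableAt (𝓡 d) (𝓡 d) (ψ ∘ p ∘ φ.symm) u := h3.comp u (h2.comp u h1)
  refine ⟨h5.differentiableAt, ?_⟩
  -- Chain rule for `ψ.symm ∘ (ψ ∘ p ∘ φ.symm)`, which agrees with `p ∘ φ.symm` near `u`.
  have key : modelDeriv d ψ.symm (ψ (p (φ.symm u))) ∘ₗ modelDeriv d (ψ ∘ p ∘ φ.symm) u =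
      modelDeriv d p (φ.symm u) ∘ₗ modelDeriv d φ.symm u := by
    refine (modelDeriv_comp (f := ψ ∘ p ∘ φ.symm) h4 h5).symm.trans
      (.trans ?_ (modelDeriv_comp h2 h1))
    apply modelDeriv_congr
    filter_upwards [(h2.comp u h1).continuousAt.preimage_mem_nhds (ψ.open_source.mem_nhds hpu)]
      with v hv using ψ.left_inv hv
  have key' := congrArg LinearMap.det key
  rw [LinearMap.det_comp, LinearMap.det_comp] at key'
  have hF : LinearMap.det (modelDeriv d (ψ ∘ p ∘ φ.symm) u) =
      (fderiv ℝ (ψ ∘ p ∘ φ.symm) u).det := by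
    rw [modelDeriv, mfderiv_eq_fderiv]
  rw [det_chartGram, det_chartGram, hp.metricForm_eq, formDet_comp, ψ.left_inv hpu, ← hF,
    ← Real.sqrt_sq_eq_abs, ← Real.sqrt_mul (sq_nonneg _), ← mul_assoc, ← mul_assoc, ← mul_pow,
    ← mul_pow, mul_comm (LinearMap.det (modelDeriv d (ψ ∘ p ∘ φ.symm) u)), key', mul_comm
    (LinearMap.det (modelDeriv d p _))]

end ChangeOfVariables

/-! ### Volume in a single chart -/

section LocalInverse

variable {X Y : Type*} [TopologicalSpace X] [TopologicalSpace Y] [MeasurableSpace X]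
  [MeasurableSpace Y] [BorelSpace X] [BorelSpace Y] (e : OpenPartialHomeomorph X Y)

lemma measurableSet_symm_preimage_inter_target {B : Set X} (hB : MeasurableSet B) :
    MeasurableSet (e.symm ⁻¹' B ∩ e.target) := by
  have h : Measurable (e.target.domRestrict e.symm) :=
    e.continuousOn_symm.domRestrict.measurable
  convert e.open_target.measurableSet.subtype_image (h hB) using 1
  ext y
  simp [and_comm]

lemma map_symm_restrict_target_apply (μ : Measure Y) {B : Set X} (hB : MeasurableSet B) :
    Measure.map e.symm (μ.restrict e.target) B = μ (e.symm ⁻¹' B ∩ e.target) := by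
  rw [Measure.map_apply_of_aemeasurable
    (e.continuousOn_symm.aemeasurable e.open_target.measurableSet) hB,
    Measure.restrict_apply' e.open_target.measurableSet]

omit [MeasurableSpace X] [MeasurableSpace Y] [BorelSpace X] [BorelSpace Y] in
lemma symm_preimage_inter_target (B : Set X) :
    e.symm ⁻¹' B ∩ e.target = e '' (B ∩ e.source) := by
  rw [inter_comm, inter_comm B, ← e.image_source_inter_eq']

end LocalInverse

section ChartVolume

variable {d : ℕ} {M : Type*} [TopologicalSpace M]
  [ChartedSpace (EuclideanSpace ℝ (Fin d)) M]
  [Bundle.RiemannianBundle (fun y : M ↦ TangentSpace (𝓡 d) y)]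
  [MeasurableSpace M] [BorelSpace M]

lemma chartVolume_apply (x : M) {B : Set M} (hB : MeasurableSet B) :
    chartVolume d M x B = ∫⁻ u in chartAt (EuclideanSpace ℝ (Fin d)) x ''
      (B ∩ (chartAt (EuclideanSpace ℝ (Fin d)) x).source),
        ENNReal.ofReal (Real.sqrt (chartGram d M x u).det) := by
  set φ := chartAt (EuclideanSpace ℝ (Fin d)) x with hφ
  rw [chartVolume, Measure.map_apply_of_aemeasurable _ hB, withDensity_apply',
    Measure.restrict_restrict' φ.open_target.measurableSet, symm_preimage_inter_target]
  exact (φ.continuousOn_symm.aemeasurable φ.open_target.measurableSet).mono_ac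
    (withDensity_absolutelyContinuous _ _)

lemma chartVolume_inter_source (x : M) {B : Set M} (hB : MeasurableSet B) :
    chartVolume d M x (B ∩ (chartAt (EuclideanSpace ℝ (Fin d)) x).source) =
      chartVolume d M x B := by
  rw [chartVolume_apply x hB, chartVolume_apply x
    (hB.inter (chartAt (EuclideanSpace ℝ (Fin d)) x).open_source.measurableSet), inter_assoc,
    inter_self]

end ChartVolume

section LocalBounds

variable {d : ℕ} {M : Type*} [EMetricSpace M]
  [ChartedSpace (EuclideanSpace ℝ (Fin d)) M] [IsManifold (𝓡 d) ∞ M]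
  [Bundle.RiemannianBundle (fun y : M ↦ TangentSpace (𝓡 d) y)]
  [IsContMDiffRiemannianBundle (𝓡 d) ∞ (EuclideanSpace ℝ (Fin d))
    (fun y : M ↦ TangentSpace (𝓡 d) y)]
  [MeasurableSpace M] [BorelSpace M]

omit [MeasurableSpace M] [BorelSpace M] in
lemma continuousAt_sqrt_det_chartGram (x : M) :
    ContinuousAt (fun u ↦ Real.sqrt (chartGram d M x u).det)
      (chartAt (EuclideanSpace ℝ (Fin d)) x x) := by
  set φ := chartAt (EuclideanSpace ℝ (Fin d)) x with hφ
  have h : ContinuousAt (chartGram d M x) (φ x) :=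
    (continuousOn_chartGram x).continuousAt
      (φ.open_target.mem_nhds (φ.map_source (mem_chart_source _ x)))
  exact Real.continuous_sqrt.continuousAt.comp ((continuous_id.matrix_det).continuousAt.comp h)

variable (d) in
lemma exists_chartVolume_eball_lt_top (x : M) :
    ∃ ρ : ℝ≥0∞, 0 < ρ ∧ Metric.eball x ρ ⊆ (chartAt (EuclideanSpace ℝ (Fin d)) x).source ∧
      chartVolume d M x (Metric.eball x ρ) < ⊤ := by
  set φ := chartAt (EuclideanSpace ℝ (Fin d)) x with hφ
  have hx : x ∈ φ.source := mem_chart_source _ x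
  have h := (continuousAt_sqrt_det_chartGram (d := d) x).eventually_le_const
    (lt_add_one (Real.sqrt (chartGram d M x (φ x)).det))
  obtain ⟨r, hr, hball⟩ := Metric.mem_nhds_iff.1 h
  have hnhds : φ.source ∩ φ ⁻¹' Metric.ball (φ x) r ∈ 𝓝 x :=
    inter_mem (φ.open_source.mem_nhds hx)
      ((φ.continuousAt hx).preimage_mem_nhds (Metric.ball_mem_nhds _ hr))
  obtain ⟨ρ, hρ, hsub⟩ := EMetric.mem_nhds_iff.1 hnhds
  refine ⟨ρ, hρ, fun y hy ↦ (hsub hy).1, ?_⟩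
  rw [chartVolume_apply x Metric.isOpen_eball.measurableSet]
  have himage : φ '' (Metric.eball x ρ ∩ φ.source) ⊆ Metric.ball (φ x) r := by
    rintro _ ⟨y, hy, rfl⟩
    exact (hsub hy.1).2
  calc _ ≤ ∫⁻ u in Metric.ball (φ x) r, ENNReal.ofReal (Real.sqrt (chartGram d M x u).det) :=
        lintegral_mono_set himage
    _ ≤ ∫⁻ _u in Metric.ball (φ x) r,
        ENNReal.ofReal (Real.sqrt (chartGram d M x (φ x)).det + 1) :=
        setLIntegral_mono' measurableSet_ball fun u hu ↦ ENNReal.ofReal_le_ofReal (hball hu)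
    _ < ⊤ := by
        rw [setLIntegral_const]
        exact ENNReal.mul_lt_top ENNReal.ofReal_lt_top measure_ball_lt_top

lemma chartVolume_eball_pos (x : M) {ρ : ℝ≥0∞} (hρ : 0 < ρ) :
    0 < chartVolume d M x (Metric.eball x ρ) := by
  set φ := chartAt (EuclideanSpace ℝ (Fin d)) x with hφ
  have hx : x ∈ φ.source := mem_chart_source _ x
  have hpos : 0 < Real.sqrt (chartGram d M x (φ x)).det :=
    Real.sqrt_pos.2 (det_chartGram_pos x (φ.map_source hx))
  have h := (continuousAt_sqrt_det_chartGram (d := d) x).eventually_const_le (half_lt_self hpos)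
  have hopen : φ.symm ⁻¹' Metric.eball x ρ ∩ φ.target ∈ 𝓝 (φ x) := by
    refine inter_mem ((φ.continuousAt_symm (φ.map_source hx)).preimage_mem_nhds ?_)
      (φ.open_target.mem_nhds (φ.map_source hx))
    rw [φ.left_inv hx]
    exact Metric.eball_mem_nhds x hρ
  obtain ⟨r, hr, hball⟩ := Metric.mem_nhds_iff.1 (inter_mem h hopen)
  rw [chartVolume_apply x Metric.isOpen_eball.measurableSet, ← symm_preimage_inter_target]
  calc 0 < ENNReal.ofReal (Real.sqrt (chartGram d M x (φ x)).det / 2) *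
        volume (Metric.ball (φ x) r) :=
        ENNReal.mul_pos (ENNReal.ofReal_pos.2 (half_pos hpos)).ne'
          (Metric.measure_ball_pos volume _ hr).ne'
    _ = ∫⁻ _u in Metric.ball (φ x) r,
        ENNReal.ofReal (Real.sqrt (chartGram d M x (φ x)).det / 2) := (setLIntegral_const _ _).symm
    _ ≤ ∫⁻ u in Metric.ball (φ x) r, ENNReal.ofReal (Real.sqrt (chartGram d M x u).det) :=
        setLIntegral_mono' measurableSet_ball fun u hu ↦ ENNReal.ofReal_le_ofReal (hball hu).1
    _ ≤ _ := lintegral_mono_set fun u hu ↦ (hball hu).2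

end LocalBounds

/-! ### Riemannian volume under the covering map -/

section Covering

variable {d : ℕ} {N M : Type*} [EMetricSpace N] [EMetricSpace M]
  [ChartedSpace (EuclideanSpace ℝ (Fin d)) N] [ChartedSpace (EuclideanSpace ℝ (Fin d)) M]
  [IsManifold (𝓡 d) ∞ N] [IsManifold (𝓡 d) ∞ M]
  [Bundle.RiemannianBundle (fun y : N ↦ TangentSpace (𝓡 d) y)]
  [Bundle.RiemannianBundle (fun y : M ↦ TangentSpace (𝓡 d) y)]
  [MeasurableSpace N] [BorelSpace N] [MeasurableSpace M] [BorelSpace M]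
  {p : N → M}

/-- The restriction of a covering to an open set on which it is injective. -/
def IsRiemannianCovering.restrictHomeomorph (hp : IsRiemannianCovering d p) (W : Set N)
    (hW : IsOpen W) (hinj : InjOn p W) [Nonempty N] : OpenPartialHomeomorph N M :=
  OpenPartialHomeomorph.ofContinuousOpenRestrict hinj.toPartialEquiv
    hp.isCoveringMap.continuous.continuousOn
    (hp.isLocalDiffeomorph.isOpenMap.domRestrict hW) hW

/-- Covering maps preserve the volume of sets on which they are injective. -/
lemma IsRiemannianCovering.chartVolume_image (hp : IsRiemannianCovering d p) (x : N) (x' : M)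
    {B : Set N} (hB : MeasurableSet B) (hpB : MeasurableSet (p '' B)) (hinj : InjOn p B)
    (hx : B ⊆ (chartAt (EuclideanSpace ℝ (Fin d)) x).source)
    (hx' : p '' B ⊆ (chartAt (EuclideanSpace ℝ (Fin d)) x').source) :
    chartVolume d M x' (p '' B) = chartVolume d N x B := by
  set φ := chartAt (EuclideanSpace ℝ (Fin d)) x with hφ
  set ψ := chartAt (EuclideanSpace ℝ (Fin d)) x' with hψ
  have hS : MeasurableSet (φ '' B) := by
    rw [← inter_eq_left.2 hx, ← symm_preimage_inter_target]
    exact measurableSet_symm_preimage_inter_target φ hB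
  have hsymm : ∀ y ∈ B, φ.symm (φ y) = y := fun y hy ↦ φ.left_inv (hx hy)
  have key : ∀ u ∈ φ '' B, _ := fun u hu ↦
    hp.sqrt_det_chartGram x x' (u := u)
      (by obtain ⟨y, hy, rfl⟩ := hu; exact φ.map_source (hx hy))
      (by obtain ⟨y, hy, rfl⟩ := hu; rw [← hφ, hsymm y hy]; exact hx' (mem_image_of_mem p hy))
  have himage : ψ '' (p '' B) = (ψ ∘ p ∘ φ.symm) '' (φ '' B) := by
    rw [image_image, image_image]
    refine image_congr fun y hy ↦ ?_
    simp only [Function.comp_apply, hsymm y hy]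
  rw [chartVolume_apply x hB, chartVolume_apply x' hpB, ← hφ, ← hψ, inter_eq_left.2 hx,
    inter_eq_left.2 hx', himage, lintegral_image_eq_lintegral_abs_det_fderiv_mul volume hS
      (fun u hu ↦ (key u hu).1.hasFDerivAt.hasFDerivWithinAt)]
  · refine setLIntegral_congr_fun hS fun u hu ↦ ?_
    rw [(key u hu).2, ENNReal.ofReal_mul (abs_nonneg _)]
    rfl
  · rintro _ ⟨y, hy, rfl⟩ _ ⟨z, hz, rfl⟩ h
    change ψ (p (φ.symm (φ y))) = ψ (p (φ.symm (φ z))) at h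
    rw [hsymm y hy, hsymm z hz] at h
    rw [hinj hy hz (ψ.injOn (hx' (mem_image_of_mem p hy)) (hx' (mem_image_of_mem p hz)) h)]

/-- The Riemannian volume of an open set that a covering maps injectively into a chart domain. -/
lemma IsRiemannianCovering.riemannianVolume_le (hp : IsRiemannianCovering d p) (x' : M)
    {W : Set N} (hW : IsOpen W) (hinj : InjOn p W)
    (hx' : p '' W ⊆ (chartAt (EuclideanSpace ℝ (Fin d)) x').source) :
    riemannianVolume d N W ≤ chartVolume d M x' (p '' W) := by
  rcases isEmpty_or_nonempty N with hN | hN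
  · rw [eq_empty_of_isEmpty W, measure_empty]; exact zero_le
  let e := hp.restrictHomeomorph W hW hinj
  have himage : ∀ B : Set N, e.symm ⁻¹' B ∩ e.target = p '' (B ∩ W) := fun B ↦
    symm_preimage_inter_target e B
  -- The supremum lies below any measure dominating all chart volumes. The second summand is
  -- infinite on every measurable set not contained in `W` and vanishes on `W`, so domination need
  -- only be checked inside `W`.
  have hle : riemannianVolume d N ≤ Measure.map e.symm ((chartVolume d M x').restrict e.target) +
      (⊤ : ℝ≥0∞) • Measure.count.restrict Wᶜ := by
    refine iSup_le fun x ↦ Measure.le_iff.2 fun B hB ↦ ?_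
    by_cases hBW : B ⊆ W
    · set φ := chartAt (EuclideanSpace ℝ (Fin d)) x with hφ
      have hB' : MeasurableSet (B ∩ φ.source) := hB.inter φ.open_source.measurableSet
      rw [Measure.add_apply, map_symm_restrict_target_apply e _ hB, himage,
        inter_eq_left.2 hBW, ← chartVolume_inter_source x hB, ← hp.chartVolume_image x x' hB'
        (by
          rw [← inter_eq_left.2 (inter_subset_left.trans hBW), ← himage]
          exact measurableSet_symm_preimage_inter_target e hB')
        (hinj.mono (inter_subset_left.trans hBW)) inter_subset_right
        ((image_mono (inter_subset_left.trans hBW)).trans hx')]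
      exact (measure_mono (image_mono inter_subset_left)).trans le_self_add
    · obtain ⟨y, hyB, hyW⟩ := not_subset.1 hBW
      have : Measure.count.restrict Wᶜ B ≠ 0 := by
        rw [Measure.restrict_apply hB, Measure.count_ne_zero_iff]
        exact ⟨y, hyB, hyW⟩
      rw [Measure.add_apply, Measure.smul_apply, smul_eq_mul, ENNReal.top_mul this]
      simp
  refine (hle W).trans_eq ?_
  rw [Measure.add_apply, Measure.smul_apply, Measure.restrict_apply hW.measurableSet,
    inter_compl_self, measure_empty, smul_zero, add_zero,
    map_symm_restrict_target_apply e _ hW.measurableSet, himage, inter_self]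

/-- One chart of `N` may not contain `W`. Second countability of `M` passes to `W`, which splits
into countably many disjoint pieces, each in one chart domain; on each piece the pulled-back volume
equals a chart volume of `N`, and countable additivity finishes. -/
lemma IsRiemannianCovering.le_riemannianVolume [SecondCountableTopology M]
    (hp : IsRiemannianCovering d p) (x' : M) {W : Set N} (hW : IsOpen W) (hinj : InjOn p W)
    (hx' : p '' W ⊆ (chartAt (EuclideanSpace ℝ (Fin d)) x').source) :
    chartVolume d M x' (p '' W) ≤ riemannianVolume d N W := by
  rcases isEmpty_or_nonempty N with hN | hN
  · rw [eq_empty_of_isEmpty W, image_empty, measure_empty]; exact zero_le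
  let e := hp.restrictHomeomorph W hW hinj
  have himage : ∀ B : Set N, e.symm ⁻¹' B ∩ e.target = p '' (B ∩ W) := fun B ↦
    symm_preimage_inter_target e B
  let ν := Measure.map e.symm ((chartVolume d M x').restrict e.target)
  have hν : ∀ B, MeasurableSet B → ν B = chartVolume d M x' (p '' (B ∩ W)) := fun B hB ↦ by
    rw [map_symm_restrict_target_apply e _ hB, himage]
  have : SecondCountableTopology W :=
    e.isOpenEmbedding_restrict.isEmbedding.secondCountableTopology
  have hLin : IsLindelof W := isLindelof_iff_lindelofSpace.2 inferInstance
  obtain ⟨r, hr, hWr⟩ := hLin.elim_countable_subcover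
    (fun x : N ↦ (chartAt (EuclideanSpace ℝ (Fin d)) x).source) (fun x ↦ (chartAt _ x).open_source)
    (fun y _ ↦ mem_iUnion.2 ⟨y, mem_chart_source _ y⟩)
  have hle : ∀ x, ∀ B, MeasurableSet B → B ⊆ W →
      B ⊆ (chartAt (EuclideanSpace ℝ (Fin d)) x).source → ν B ≤ riemannianVolume d N B := by
    intro x B hB hBW hBx
    rw [hν B hB, inter_eq_left.2 hBW, hp.chartVolume_image x x' hB _ (hinj.mono hBW) hBx
      ((image_mono hBW).trans hx')]
    · exact le_iSup (fun x ↦ chartVolume d N x) x B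
    · rw [← inter_eq_left.2 hBW, ← himage]
      exact measurableSet_symm_preimage_inter_target e hB
  obtain ⟨f, hf⟩ := countable_iff_exists_subset_range.1 hr
  let s : ℕ → Set N := fun k ↦ W ∩ (chartAt (EuclideanSpace ℝ (Fin d)) (f k)).source
  have hs : ∀ k, MeasurableSet (s k) := fun k ↦
    (hW.inter (chartAt _ (f k)).open_source).measurableSet
  have hWs : W = ⋃ k, disjointed s k := by
    rw [iUnion_disjointed]
    refine subset_antisymm (fun y hy ↦ ?_) (iUnion_subset fun k ↦ inter_subset_left)
    obtain ⟨x, hx, hyx⟩ := mem_iUnion₂.1 (hWr hy)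
    obtain ⟨k, rfl⟩ := hf hx
    exact mem_iUnion.2 ⟨k, hy, hyx⟩
  calc chartVolume d M x' (p '' W) = ν W := by rw [hν W hW.measurableSet, inter_self]
    _ = ∑' k, ν (disjointed s k) := by
        conv_lhs => rw [hWs]
        exact measure_iUnion (disjoint_disjointed s) (.disjointed hs)
    _ ≤ ∑' k, riemannianVolume d N (disjointed s k) :=
        ENNReal.tsum_le_tsum fun k ↦ hle (f k) _ (.disjointed hs k)
          ((disjointed_subset s k).trans inter_subset_left)
          ((disjointed_subset s k).trans inter_subset_right)
    _ = riemannianVolume d N W := by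
        conv_rhs => rw [hWs]
        exact (measure_iUnion (disjoint_disjointed s) (.disjointed hs)).symm

end Covering

/-- Pure arithmetic: affine comparisons become linear ones for large `C * r`, and monotonicity with
the values at `η`, `1` and `0` handles small `C * r`. -/
lemma schwarzEquiv_of_bounds {γ : ℝ → ℝ≥0∞} {g : ℕ → ℝ≥0∞} (hγ : Monotone γ) (hg : Monotone g)
    (hg0 : g 0 = 1) {s D L c c' Q Q' η : ℝ} {K K₀ : ℕ} (hs : 0 < s) (hD : 0 ≤ D) (hL : 0 ≤ L)
    (hc : 0 < c) (hc' : 0 < c') (hQ : 0 ≤ Q) (hQ' : 0 ≤ Q') (hη : 0 < η)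
    (hup : ∀ (n : ℕ) (r : ℝ), r ≤ n * s → γ r ≤ ENNReal.ofReal Q * g (K₀ + n * K))
    (hlow : ∀ (n : ℕ) (r : ℝ), D + n * L ≤ r → ENNReal.ofReal c * g n ≤ γ r)
    (hγη : γ η ≤ ENNReal.ofReal Q') (hγ1 : ENNReal.ofReal c' ≤ γ 1) :
    SchwarzEquiv γ (fun r ↦ g ⌊r⌋₊) := by
  have hg1 : ∀ n, 1 ≤ g n := fun n ↦ hg0 ▸ hg n.zero_le
  -- `C` will be the inverse of this sum, so `C` times any of its terms is at most 1. The factors 2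
  -- let two error terms share `r`.
  have hT : 0 < 1 + 1 / c + 1 / c' + 2 * L + 2 * D + Q + Q' + 2 * K / s + 2 * (K₀ + K) / η := by
    positivity
  obtain ⟨C, hC, hCT⟩ : ∃ C : ℝ, 0 < C ∧
      C * (1 + 1 / c + 1 / c' + 2 * L + 2 * D + Q + Q' + 2 * K / s + 2 * (K₀ + K) / η) = 1 :=
    ⟨_, inv_pos.2 hT, inv_mul_cancel₀ hT.ne'⟩
  have key : ∀ x, x ≤ 1 + 1 / c + 1 / c' + 2 * L + 2 * D + Q + Q' + 2 * K / s + 2 * (K₀ + K) / η →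
      C * x ≤ 1 := fun x hx ↦ (mul_le_mul_of_nonneg_left hx hC.le).trans_eq hCT
  have e1 : 0 < 1 / c := by positivity
  have e2 : 0 < 1 / c' := by positivity
  have e3 : 0 ≤ 2 * K / s := by positivity
  have e4 : 0 ≤ 2 * (K₀ + K) / η := by positivity
  have hCc : C ≤ c := by
    have := key (1 / c) (by linarith)
    rwa [mul_one_div, div_le_one hc] at this
  have hCc' : C ≤ c' := by
    have := key (1 / c') (by linarith)
    rwa [mul_one_div, div_le_one hc'] at this
  have hCL := key (2 * L) (by linarith)
  have hCD := key (2 * D) (by linarith)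
  have hCQ := key Q (by linarith)
  have hCQ' := key Q' (by linarith)
  have hCs := key (2 * K / s) (by linarith)
  have hCη : C * (2 * (K₀ + K)) ≤ η := by
    have := key (2 * (K₀ + K) / η) (by linarith)
    rwa [← mul_div_assoc, div_le_one hη] at this
  refine ⟨C, hC, fun r hr ↦ ⟨?_, ?_⟩⟩
  -- If `C * r < 1`, the graph ball is one vertex. Otherwise `D ≤ r / 2` and `C * r * L ≤ r / 2`.
  · rcases lt_or_ge (C * r) 1 with h | h
    · simp only [Nat.floor_eq_zero.2 h, hg0, mul_one]
      exact (ENNReal.ofReal_le_ofReal hCc').trans (hγ1.trans (hγ hr))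
    · refine le_trans ?_ (hlow ⌊C * r⌋₊ r ?_)
      · gcongr
      · have h1 : (⌊C * r⌋₊ : ℝ) * L ≤ C * r * L := by
          gcongr
          exact Nat.floor_le (by positivity)
        nlinarith
  -- For `C * r ≤ η` the volume is at most `Q'` and `g ≥ 1`. Otherwise `r ≥ 2 * (K₀ + K)` absorbs
  -- the additive error, including the rounding up in the number of steps.
  · rcases le_or_gt (C * r) η with h | h
    · calc ENNReal.ofReal C * γ (C * r) ≤ ENNReal.ofReal C * ENNReal.ofReal Q' := by
            gcongr
            exact (hγ h).trans hγη
        _ = ENNReal.ofReal (C * Q') := (ENNReal.ofReal_mul hC.le).symm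
        _ ≤ 1 := ENNReal.ofReal_le_one.2 hCQ'
        _ ≤ _ := hg1 _
    · have hn : C * r ≤ ⌈C * r / s⌉₊ * s := (div_le_iff₀ hs).1 (Nat.le_ceil _)
      calc ENNReal.ofReal C * γ (C * r)
          ≤ ENNReal.ofReal C * (ENNReal.ofReal Q * g (K₀ + ⌈C * r / s⌉₊ * K)) := by
            gcongr
            exact hup _ _ hn
        _ = ENNReal.ofReal (C * Q) * g (K₀ + ⌈C * r / s⌉₊ * K) := by
            rw [ENNReal.ofReal_mul hC.le, mul_assoc]
        _ ≤ 1 * g (K₀ + ⌈C * r / s⌉₊ * K) := by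
            gcongr
            exact ENNReal.ofReal_le_one.2 hCQ
        _ = g (K₀ + ⌈C * r / s⌉₊ * K) := one_mul _
        _ ≤ g ⌊r⌋₊ := by
            refine hg (Nat.le_floor ?_)
            have h1 : (⌈C * r / s⌉₊ : ℝ) ≤ C * r / s + 1 := (Nat.ceil_lt_add_one (by positivity)).le
            have h2 : (⌈C * r / s⌉₊ : ℝ) * K ≤ (C * r / s + 1) * K := by gcongr
            have h3 : (C * r / s + 1) * K = (C * (2 * K / s)) * r / 2 + K := by ring
            have h4 : C * (2 * K / s) * r ≤ 1 * r := by gcongr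
            have h5 : 2 * (K₀ + K : ℝ) ≤ r := le_of_mul_le_mul_left (hCη.trans h.le) hC
            push_cast
            linarith

section Graph

variable {G : Type*} [Group G] {H : Subgroup G} {A : Set G}

lemma setOf_reach_zero (v : G ⧸ H) : {w | Reach H A 0 v w} = {v} := by
  ext w
  constructor
  · rintro ⟨P, hP⟩
    have := Quiver.Path.eq_of_length_zero P (Nat.le_zero.1 hP)
    exact congrArg Quiver.SchreierGraph.toVertex this.symm
  · rintro rfl
    exact Reach.refl _ 0

end Graph

section Measure

/-- For infinite `S` the right side is infinite, as `Q ≠ 0`; no countability is needed. -/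
lemma measure_biUnion_le_mul_encard {α ι : Type*} [MeasurableSpace α] (μ : Measure α) (S : Set ι)
    {g : ι → Set α} {Q : ℝ≥0∞} (hQ : Q ≠ 0) (h : ∀ i ∈ S, μ (g i) ≤ Q) :
    μ (⋃ i ∈ S, g i) ≤ Q * (S.encard : ℝ≥0∞) := by
  rcases S.finite_or_infinite with hS | hS
  · calc μ (⋃ i ∈ S, g i) ≤ ∑' i : S, μ (g i) := measure_biUnion_le μ hS.countable g
      _ ≤ ∑' _i : S, Q := ENNReal.tsum_le_tsum fun i ↦ h i i.2
      _ = Q * (S.encard : ℝ≥0∞) := by rw [ENNReal.tsum_set_const, mul_comm]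
  · rw [hS.encard_eq, ENat.toENNReal_top, ENNReal.mul_top hQ]
    exact le_top

end Measure

/-! ### The two growth bounds and their combination -/

section Growth

variable {d : ℕ} {N M : Type*} [EMetricSpace N] [EMetricSpace M]
  [ChartedSpace (EuclideanSpace ℝ (Fin d)) N] [ChartedSpace (EuclideanSpace ℝ (Fin d)) M]
  [IsManifold (𝓡 d) ∞ N] [IsManifold (𝓡 d) ∞ M]
  [Bundle.RiemannianBundle (fun y : N ↦ TangentSpace (𝓡 d) y)]
  [Bundle.RiemannianBundle (fun y : M ↦ TangentSpace (𝓡 d) y)]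
  [IsRiemannianManifold (𝓡 d) N] [IsRiemannianManifold (𝓡 d) M]
  [MeasurableSpace N] [BorelSpace N] [MeasurableSpace M] [BorelSpace M]
  {p : N → M} {δ : ℝ≥0∞}

lemma IsRiemannianCovering.riemannianVolume_eball [SecondCountableTopology M]
    (hp : IsRiemannianCovering d p) (hδ : ∀ x : M, PathsHomotopicIn (Metric.eball x δ))
    (q : N) {ρ : ℝ≥0∞} (hρδ : ρ ≤ δ)
    (hρ : Metric.eball (p q) ρ ⊆ (chartAt (EuclideanSpace ℝ (Fin d)) (p q)).source) :
    riemannianVolume d N (Metric.eball q ρ) = chartVolume d M (p q) (Metric.eball (p q) ρ) := by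
  have hinj : InjOn p (Metric.eball q ρ) :=
    (hp.injOn_eball hδ q).mono (Metric.eball_subset_eball hρδ)
  rw [← hp.image_eball] at hρ ⊢
  exact le_antisymm (hp.riemannianVolume_le (p q) Metric.isOpen_eball hinj hρ)
    (hp.le_riemannianVolume (p q) Metric.isOpen_eball hinj hρ)

variable {x₀ : M} {H : Subgroup (FundamentalGroup M x₀)}
  {A : Set (FundamentalGroup M x₀)} {f : FundamentalGroup M x₀ ⧸ H → p ⁻¹' {x₀}}
  [IsContMDiffRiemannianBundle (𝓡 d) ∞ (EuclideanSpace ℝ (Fin d))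
    (fun y : M ↦ TangentSpace (𝓡 d) y)]
  [CompactSpace M]

/-- The volume of a ball is bounded above by the growth of the Schreier graph. -/
lemma IsRiemannianCovering.exists_riemannianVolume_eball_le [PathConnectedSpace M]
    [SecondCountableTopology M]
    (hp : IsRiemannianCovering d p) (hδ0 : 0 < δ) (hδt : δ ≠ ⊤)
    (hδ : ∀ x : M, PathsHomotopicIn (Metric.eball x δ)) (hgen : Subgroup.closure A = ⊤)
    (hf : Function.Bijective f)
    (hfs : ∀ (g : FundamentalGroup M x₀) v, f (g • v) = hp.isCoveringMap.monodromy g (f v))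
    (y : N) (v : FundamentalGroup M x₀ ⧸ H) :
    ∃ (K K₀ : ℕ) (Q : ℝ≥0∞), Q ≠ ⊤ ∧ ∀ (n : ℕ) (r : ℝ≥0∞), r ≤ n * (δ / 3) →
      riemannianVolume d N (Metric.eball y r) ≤
        Q * ((encard {w | Reach H A (K₀ + n * K) v w} : ℕ∞) : ℝ≥0∞) := by
  choose ρ₀ hρ₀ hρsrc hρfin using exists_chartVolume_eball_lt_top d (M := M)
  set s := δ / 3 with hs
  have hs0 : 0 < s := ENNReal.div_pos hδ0.ne' (by simp)
  have hst : s ≠ ⊤ := ENNReal.div_ne_top hδt (by simp)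
  have hsδ : s + s + s = δ := ENNReal.add_thirds δ
  have hsδ' : s ≤ δ := by rw [← hsδ]; exact le_add_self
  let ρ : M → ℝ≥0∞ := fun z ↦ min (ρ₀ z) s
  have hρ0 : ∀ z, 0 < ρ z := fun z ↦ lt_min (hρ₀ z) hs0
  obtain ⟨t, -, ht⟩ := (isCompact_univ (X := M)).elim_nhds_subcover
    (fun z ↦ Metric.eball z (ρ z)) fun z _ ↦ Metric.eball_mem_nhds z (hρ0 z)
  have ht' : ∀ x, ∃ z ∈ t, x ∈ Metric.eball z (ρ z) := fun x ↦ by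
    simpa using ht (mem_univ x)
  let c : ∀ z, Path.Homotopic.Quotient z x₀ := fun z ↦ .mk (PathConnectedSpace.somePath z x₀)
  obtain ⟨K, hK⟩ := hp.exists_reach_of_mem_cell (c := c) hδ hgen hf hfs ht' hs0 hst hsδ.le
    fun z ↦ min_le_right _ _
  obtain ⟨z₀, hz₀, w₀, hw₀⟩ := hp.exists_mem_cell (c := c) hf.surjective ht' y
  obtain ⟨K₀, hK₀⟩ := exists_reach hgen v w₀
  -- The summand 1 ensures `Q ≠ 0`.
  let Q : ℝ≥0∞ := 1 + ∑ z ∈ t, chartVolume d M z (Metric.eball z (ρ z))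
  have hQt : Q ≠ ⊤ := by
    refine ENNReal.add_ne_top.2 ⟨ENNReal.one_ne_top, ENNReal.sum_ne_top.2 fun z _ ↦ ?_⟩
    exact ne_top_of_le_ne_top (hρfin z).ne
      (measure_mono (Metric.eball_subset_eball (min_le_left _ _)))
  have hQ0 : Q ≠ 0 := (zero_lt_one.trans_le le_self_add).ne'
  have hcell : ∀ z ∈ t, ∀ w,
      riemannianVolume d N (cell hp.isCoveringMap f c ρ z w) ≤ Q := by
    intro z hz w
    obtain ⟨q, rfl, hq⟩ := exists_cell_subset_eball (f := f) (c := c) hp.isCoveringMap ρ z w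
    refine (measure_mono hq).trans ?_
    rw [hp.riemannianVolume_eball hδ q ((min_le_right _ _).trans hsδ')
      ((Metric.eball_subset_eball (min_le_left _ _)).trans (hρsrc _))]
    exact (Finset.single_le_sum (f := fun z ↦ chartVolume d M z (Metric.eball z (ρ z)))
      (fun _ _ ↦ zero_le) hz).trans le_add_self
  refine ⟨K, K₀, t.card * Q, ENNReal.mul_ne_top (ENNReal.natCast_ne_top _) hQt,
    fun n r hr ↦ ?_⟩
  have hsub : Metric.eball y r ⊆ ⋃ z ∈ t, ⋃ w ∈ {w | Reach H A (K₀ + n * K) v w},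
      cell hp.isCoveringMap f c ρ z w := by
    intro q hq
    obtain ⟨z, hz, w, hw⟩ := hp.exists_mem_cell (c := c) hf.surjective ht' q
    simp only [mem_iUnion]
    exact ⟨z, hz, w, hK₀.trans (hK n y q ((Metric.mem_eball'.1 hq).trans_le hr) z₀ hz₀ z hz w₀ w
      hw₀ hw), hw⟩
  calc riemannianVolume d N (Metric.eball y r) ≤ _ := measure_mono hsub
    _ ≤ ∑ z ∈ t, riemannianVolume d N (⋃ w ∈ {w | Reach H A (K₀ + n * K) v w},
        cell hp.isCoveringMap f c ρ z w) := measure_biUnion_finset_le _ _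
    _ ≤ ∑ _z ∈ t, Q * ((encard {w | Reach H A (K₀ + n * K) v w} : ℕ∞) : ℝ≥0∞) :=
        Finset.sum_le_sum fun z hz ↦
          measure_biUnion_le_mul_encard _ _ hQ0 fun w _ ↦ hcell z hz w
    _ = _ := by rw [Finset.sum_const, nsmul_eq_mul, mul_assoc]

omit [CompactSpace M] in
/-- The volume of a ball is bounded below by the growth of the Schreier graph. -/
lemma IsRiemannianCovering.exists_le_riemannianVolume_eball [SecondCountableTopology M]
    [PreconnectedSpace N]
    (hp : IsRiemannianCovering d p) (hδ0 : 0 < δ) (hδt : δ ≠ ⊤)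
    (hδ : ∀ x : M, PathsHomotopicIn (Metric.eball x δ)) (hfin : A.Finite)
    (hf : Function.Injective f)
    (hfs : ∀ (g : FundamentalGroup M x₀) v, f (g • v) = hp.isCoveringMap.monodromy g (f v))
    (y : N) (v : FundamentalGroup M x₀ ⧸ H) :
    ∃ D L k : ℝ≥0∞, D ≠ ⊤ ∧ L ≠ ⊤ ∧ 0 < k ∧ ∀ (n : ℕ) (r : ℝ≥0∞), D + n * L ≤ r →
      k * ((encard {w | Reach H A n v w} : ℕ∞) : ℝ≥0∞) ≤
        riemannianVolume d N (Metric.eball y r) := by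
  obtain ⟨ρ, hρ, hρsrc, -⟩ := exists_chartVolume_eball_lt_top d x₀
  let ε := min ρ (δ / 2)
  have hε0 : 0 < ε := lt_min hρ (ENNReal.half_pos hδ0.ne')
  have hεδ : ε + ε ≤ δ :=
    (add_le_add (min_le_right _ _) (min_le_right _ _)).trans_eq (ENNReal.add_halves δ)
  have hεδ' : ε ≤ δ := le_self_add.trans hεδ
  choose L hLt hL using fun a : FundamentalGroup M x₀ ↦
    hp.exists_edist_monodromy_le hδ0 hδt hδ (x := x₀) (x' := x₀) a
  let L' := ∑ a ∈ hfin.toFinset, L a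
  have hreach : ∀ {n w}, Reach H A n v w → edist (f v : N) (f w) ≤ n * L' := fun h ↦
    h.edist_le (f := fun w ↦ (f w : N)) fun a ha u ↦ by
      rw [hfs]
      exact (hL a (f u)).trans (Finset.single_le_sum (f := L) (fun _ _ ↦ zero_le)
        (hfin.mem_toFinset.2 ha))
  -- A ball of infinite radius is clopen, so connectedness makes distances finite.
  have hyv : edist y (f v) ≠ ⊤ := by
    have : Metric.eball y ⊤ = univ :=
      IsClopen.eq_univ ⟨Metric.isClosed_eball_top, Metric.isOpen_eball⟩ ⟨y, Metric.mem_eball_self ENNReal.zero_lt_top⟩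
    exact (Metric.mem_eball'.1 (this.symm ▸ mem_univ (f v : N))).ne
  have hball : ∀ w, riemannianVolume d N (Metric.eball (f w : N) ε) =
      chartVolume d M x₀ (Metric.eball x₀ ε) := by
    intro w
    have hw : p (f w) = x₀ := (f w).2
    have := hp.riemannianVolume_eball hδ (f w : N) hεδ' (by
      rw [hw]
      exact (Metric.eball_subset_eball (min_le_left _ _)).trans hρsrc)
    rwa [hw] at this
  -- A common point would be within δ of two points of one fibre.
  have hdisj : ∀ w w', w ≠ w' →
      Disjoint (Metric.eball (f w : N) ε) (Metric.eball (f w' : N) ε) := by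
    intro w w' hne
    refine disjoint_left.2 fun q hq hq' ↦ hne (hf (Subtype.ext ?_))
    have h1 : p (f w) = x₀ := (f w).2
    have h2 : p (f w') = x₀ := (f w').2
    exact hp.eq_of_edist_lt hδ (hq.trans_le hεδ') (hq'.trans_le hεδ') (h1.trans h2.symm)
  refine ⟨edist y (f v) + ε, L', chartVolume d M x₀ (Metric.eball x₀ ε),
    ENNReal.add_ne_top.2 ⟨hyv, ne_top_of_le_ne_top hδt hεδ'⟩, ENNReal.sum_ne_top.2 fun a _ ↦ hLt a,
    chartVolume_eball_pos x₀ hε0, fun n r hr ↦ ?_⟩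
  calc _ = ∑' w : {w | Reach H A n v w}, riemannianVolume d N (Metric.eball (f w : N) ε) := by
        simp only [hball]
        rw [ENNReal.tsum_set_const, mul_comm]
    _ ≤ riemannianVolume d N (⋃ w : {w | Reach H A n v w}, Metric.eball (f w : N) ε) :=
        tsum_meas_le_meas_iUnion_of_disjoint _ (fun _ ↦ Metric.isOpen_eball.measurableSet)
          fun w w' hne ↦ hdisj w w' fun h ↦ hne (Subtype.ext h)
    _ ≤ riemannianVolume d N (Metric.eball y r) := by
        refine measure_mono (iUnion_subset fun w q hq ↦ Metric.mem_eball'.2 ?_)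
        calc edist y q ≤ edist y (f v) + edist (f v : N) (f w) + edist (f w : N) q :=
              edist_triangle4 _ _ _ _
          _ < edist y (f v) + n * L' + ε := by
              refine ENNReal.add_lt_add_of_le_of_lt ?_ ?_ (Metric.mem_eball'.1 hq)
              · exact ENNReal.add_ne_top.2 ⟨hyv, ne_top_of_le_ne_top (ENNReal.mul_ne_top
                  (ENNReal.natCast_ne_top n) (ENNReal.sum_ne_top.2 fun a _ ↦ hLt a))
                  (hreach w.2)⟩
              · gcongr
                exact hreach w.2
          _ = edist y (f v) + ε + n * L' := by ring
          _ ≤ r := hr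

/-- The volume growth of a covering of a compact manifold is equivalent to the growth of a Schreier
graph whose vertices correspond to the points of a fibre. -/
lemma IsRiemannianCovering.schwarzEquiv [PathConnectedSpace M] [PreconnectedSpace N]
    (hp : IsRiemannianCovering d p) (hfin : A.Finite) (hgen : Subgroup.closure A = ⊤)
    (hf : Function.Bijective f)
    (hfs : ∀ (g : FundamentalGroup M x₀) v, f (g • v) = hp.isCoveringMap.monodromy g (f v))
    (y : N) (v : FundamentalGroup M x₀ ⧸ H) :
    SchwarzEquiv (volumeGrowth d y) (schreierGrowth H A v) := by
  have : SecondCountableTopology M := EMetric.secondCountable_of_sigmaCompact M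
  obtain ⟨δ, hδ0, hδt, hδ⟩ := exists_pathsHomotopicIn_eball d M
  obtain ⟨K, K₀, Q, hQ, hup⟩ := hp.exists_riemannianVolume_eball_le hδ0 hδt hδ hgen hf hfs y v
  obtain ⟨D, L, k, hD, hL, hk, hlow⟩ :=
    hp.exists_le_riemannianVolume_eball hδ0 hδt hδ hfin hf.injective hfs y v
  obtain ⟨ρ, hρ, hρsrc, hρfin⟩ := exists_chartVolume_eball_lt_top d (p y)
  have hsmall : ∀ ε ≤ min ρ δ, riemannianVolume d N (Metric.eball y ε) =
      chartVolume d M (p y) (Metric.eball (p y) ε) := fun ε hε ↦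
    hp.riemannianVolume_eball hδ y (hε.trans (min_le_right _ _))
      ((Metric.eball_subset_eball (hε.trans (min_le_left _ _))).trans hρsrc)
  -- Below this radius the ball about `y` has the volume of a ball in one chart of `M`, which is
  -- finite.
  obtain ⟨η, hη0, hηρ⟩ : ∃ η : ℝ, 0 < η ∧ ENNReal.ofReal η ≤ min ρ δ := by
    obtain ⟨η, hη⟩ := ENNReal.lt_iff_exists_real_btwn.1 (lt_min hρ hδ0)
    exact ⟨η, ENNReal.ofReal_pos.1 hη.2.1, hη.2.2.le⟩
  have hfinη : volumeGrowth d y η ≠ ⊤ := by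
    rw [volumeGrowth, hsmall _ hηρ]
    exact ne_top_of_le_ne_top hρfin.ne
      (measure_mono (Metric.eball_subset_eball (hηρ.trans (min_le_left _ _))))
  obtain ⟨c', hc', hc'1⟩ : ∃ c' : ℝ, 0 < c' ∧ ENNReal.ofReal c' ≤ volumeGrowth d y 1 := by
    have h : 0 < volumeGrowth d y 1 := by
      refine lt_of_lt_of_le ?_ (measure_mono (Metric.eball_subset_eball
        (min_le_left (ENNReal.ofReal 1) (min ρ δ))))
      rw [hsmall _ (min_le_right _ _)]
      exact chartVolume_eball_pos _ (lt_min (by simp) (lt_min hρ hδ0))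
    obtain ⟨c', hc'⟩ := ENNReal.lt_iff_exists_real_btwn.1 h
    exact ⟨c', ENNReal.ofReal_pos.1 hc'.2.1, hc'.2.2.le⟩
  obtain ⟨c, hc, hck⟩ : ∃ c : ℝ, 0 < c ∧ ENNReal.ofReal c ≤ k := by
    obtain ⟨c, hc⟩ := ENNReal.lt_iff_exists_real_btwn.1 hk
    exact ⟨c, ENNReal.ofReal_pos.1 hc.2.1, hc.2.2.le⟩
  have hs0 : 0 < δ / 3 := ENNReal.div_pos hδ0.ne' (by simp)
  have hst : δ / 3 ≠ ⊤ := ENNReal.div_ne_top hδt (by simp)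
  let g : ℕ → ℝ≥0∞ := fun n ↦ ((encard {w | Reach H A n v w} : ℕ∞) : ℝ≥0∞)
  have hgrowth : schreierGrowth H A v = fun r ↦ g ⌊r⌋₊ := funext fun r ↦ schreierGrowth_eq v r
  have hγ : Monotone (volumeGrowth d y) := fun r r' h ↦
    measure_mono (Metric.eball_subset_eball (ENNReal.ofReal_le_ofReal h))
  have hg : Monotone g := fun n m h ↦
    ENat.toENNReal_le.2 (encard_le_encard fun w hw ↦ Reach.mono hw h)
  have hg0 : g 0 = 1 := by
    simp only [g, setOf_reach_zero, encard_singleton, ENat.toENNReal_one]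
  rw [hgrowth]
  refine schwarzEquiv_of_bounds hγ hg hg0 (D := D.toReal) (L := L.toReal) (Q := Q.toReal)
    (K := K) (K₀ := K₀)
    (ENNReal.toReal_pos hs0.ne' hst) ENNReal.toReal_nonneg ENNReal.toReal_nonneg hc hc'
    ENNReal.toReal_nonneg ENNReal.toReal_nonneg hη0 (fun n r hr ↦ (hup n _ ?_).trans_eq ?_)
    (fun n r hr ↦ le_trans ?_ (hlow n (ENNReal.ofReal r) ?_))
    (ENNReal.ofReal_toReal hfinη).ge hc'1
  · rw [← ENNReal.ofReal_toReal hst, ← ENNReal.ofReal_natCast, ← ENNReal.ofReal_mul n.cast_nonneg]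
    exact ENNReal.ofReal_le_ofReal hr
  · rw [ENNReal.ofReal_toReal hQ]
  · gcongr
  · rw [← ENNReal.ofReal_toReal hD, ← ENNReal.ofReal_toReal hL, ← ENNReal.ofReal_natCast,
      ← ENNReal.ofReal_mul n.cast_nonneg, ← ENNReal.ofReal_add ENNReal.toReal_nonneg
        (by positivity)]
    exact ENNReal.ofReal_le_ofReal hr

end Growth

end CoverGrowth

end

open CoverGrowth

theorem mainTheorem4 {d : ℕ}
    -- a compact connected Riemannian manifold `M`
    {M : Type*} [EMetricSpace M] [ChartedSpace (EuclideanSpace ℝ (Fin d)) M]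
    [IsManifold (𝓡 d) ∞ M] [Bundle.RiemannianBundle (fun y : M ↦ TangentSpace (𝓡 d) y)]
    [IsContMDiffRiemannianBundle (𝓡 d) ∞ (EuclideanSpace ℝ (Fin d))
      (fun y : M ↦ TangentSpace (𝓡 d) y)]
    [IsRiemannianManifold (𝓡 d) M] [CompactSpace M] [ConnectedSpace M]
    -- a subgroup `H` and a finite generating set `A` of its fundamental group
    (x₀ : M) (H : Subgroup (FundamentalGroup M x₀)) (A : Set (FundamentalGroup M x₀))
    (hfin : A.Finite) (hgen : Subgroup.closure A = ⊤)
    -- a connected Riemannian manifold `N`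
    {N : Type*} [EMetricSpace N] [ChartedSpace (EuclideanSpace ℝ (Fin d)) N]
    [IsManifold (𝓡 d) ∞ N] [Bundle.RiemannianBundle (fun y : N ↦ TangentSpace (𝓡 d) y)]
    [IsContMDiffRiemannianBundle (𝓡 d) ∞ (EuclideanSpace ℝ (Fin d))
      (fun y : N ↦ TangentSpace (𝓡 d) y)]
    [IsRiemannianManifold (𝓡 d) N] [ConnectedSpace N] [MeasurableSpace N] [BorelSpace N]
    -- a covering `p : N → M` with the lifted metric, which corresponds to `H`
    (p : C(N, M)) (hp : CoverGrowth.IsRiemannianCovering d p)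
    (y₀ : N) (hy₀ : p y₀ = x₀) (hH : (FundamentalGroup.mapOfEq p hy₀).range = H)
    -- base points of the growth functions
    (y : N) (v : FundamentalGroup M x₀ ⧸ H) :
    CoverGrowth.SchwarzEquiv (CoverGrowth.volumeGrowth d y)
      (CoverGrowth.schreierGrowth H A v) := by
  -- The statement measures volume only in `N`; the Borel structure on `M` serves the comparison.
  let _ : MeasurableSpace M := borel M
  have : BorelSpace M := ⟨rfl⟩
  have : LocallyPathConnectedSpace M :=
    ChartedSpace.locallyPathConnectedSpace (EuclideanSpace ℝ (Fin d)) M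
  have : LocallyPathConnectedSpace N :=
    ChartedSpace.locallyPathConnectedSpace (EuclideanSpace ℝ (Fin d)) N
  have : PathConnectedSpace M := pathConnectedSpace_iff_connectedSpace.2 inferInstance
  have : PathConnectedSpace N := pathConnectedSpace_iff_connectedSpace.2 inferInstance
  obtain ⟨f, hf, hfs⟩ := exists_coset_fibre_bijective p hp.isCoveringMap hy₀ hH
  exact hp.schwarzEquiv hfin hgen hf hfs y v
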